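/- **Conventions.** All C*-algebras are unital, complex and nonzero; $\mathfrak{sa}(\mathfrak A)$ is the self-adjoint part of $\mathfrak A$ and $\mathscr S(\mathfrak A)$ its state space; for self-adjoint $a,b$ put $a\circ b=\frac{ab+ba}{2}$ and $\{a,b\}=\frac{ab-ba}{2i}$. A function $F:[0,\infty]^4\to[0,\infty]$ is *admissible* if it is weakly increasing for the product order, finite at finite arguments, and $x l_y+y l_x\le F(x,y,l_x,l_y)$ for all $x,y,l_x,l_y\in[0,\infty)$. An *$F$-quasi-Leibniz quantum compact metric space* is a pair $(\mathfrak A,\mathsf L)$ of a C*-algebra $\mathfrak A$ and a seminorm $\mathsf L$ on a dense subspace $\mathrm{dom}(\mathsf L)$ of $\mathfrak{sa}(\mathfrak A)$ closed under both products (with $\mathsf L=\infty$ off $\mathrm{dom}(\mathsf L)$) such that: $\mathsf L(a)=0$ if and only if $a\in\mathbb R1$; the metric $\mathsf{mk}_{\mathsf L}(\mu,\nu)=\sup\{|\mu(a)-\nu(a)|:\mathsf L(a)\le1\}$ metrizes the weak* topology of $\mathscr S(\mathfrak A)$; $\max\{\mathsf L(a\circ b),\mathsf L(\{a,b\})\}\le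 F(\|a\|,\|b\|,\mathsf L(a),\mathsf L(b))$ for all $a,b\in\mathrm{dom}(\mathsf L)$; and $\mathsf L$ is norm lower semicontinuous on $\mathfrak{sa}(\mathfrak A)$. A *Lipschitz linear map* $(\mathfrak A,\mathsf L_{\mathfrak A})\to(\mathfrak B,\mathsf L_{\mathfrak B})$ is a continuous linear map $\varphi:\mathfrak A\to\mathfrak B$ with $\varphi(1)=1$ and $\varphi(\mathrm{dom}(\mathsf L_{\mathfrak A}))\subseteq\mathrm{dom}(\mathsf L_{\mathfrak B})$; it is a *Lipschitz morphism* if it is moreover a *-homomorphism. For two such maps put $\mathsf{mkD}(\varphi,\psi)=\sup\{\|\varphi(a)-\psi(a)\|:\mathsf L_{\mathfrak A}(a)\le1\}$, and for $\mathfrak A=\mathfrak B$ put $\mathsf{mk\ell}(\varphi)=\mathsf{mkD}(\mathrm{id},\varphi)$. A *quantum isometry* $\pi:(\mathfrak D,\mathsf L_{\mathfrak D})\to(\mathfrak A,\mathsf L_{\mathfrak A})$ is a surjective *-homomorphism with $\mathsf L_{\mathfrak A}(a)=\inf\{\mathsf L_{\mathfrak D}(d):\pi(d)=a\}$ for all $a\in\mathfrak{sa}(\mathfrak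 A)$; a *full quantum isometry* is a *-isomorphism $h$ with $\mathsf L_{\mathfrak B}\circ h=\mathsf L_{\mathfrak A}$. An *($F$-)tunnel* $\tau=(\mathfrak D,\mathsf L_{\mathfrak D},\pi,\rho)$ from $(\mathfrak A,\mathsf L_{\mathfrak A})$ to $(\mathfrak B,\mathsf L_{\mathfrak B})$ is an $F$-quasi-Leibniz quantum compact metric space $(\mathfrak D,\mathsf L_{\mathfrak D})$ with quantum isometries $\pi$ onto $(\mathfrak A,\mathsf L_{\mathfrak A})$ and $\rho$ onto $(\mathfrak B,\mathsf L_{\mathfrak B})$. Its inverse is $\tau^{-1}=(\mathfrak D,\mathsf L_{\mathfrak D},\rho,\pi)$, its *extent* $\chi(\tau)$ is the larger of the Hausdorff distances, for $\mathsf{mk}_{\mathsf L_{\mathfrak D}}$, from $\mathscr S(\mathfrak D)$ to $\{\mu\circ\pi:\mu\in\mathscr S(\mathfrak A)\}$ and to $\{\mu\circ\rho:\mu\in\mathscr S(\mathfrak B)\}$, and the *target set* of $a\in\mathrm{dom}(\mathsf L_{\mathfrak A})$ for $l\ge\mathsf L_{\mathfrak A}(a)$ is $\mathfrak t_\tau(a|l)=\{\rho(d):d\in\mathfrak{sa}(\mathfrak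 D),\ \mathsf L_{\mathfrak D}(d)\le l,\ \pi(d)=a\}$. A class $\mathcal T$ of tunnels is *appropriate* for a nonempty class $\mathcal C$ of $F$-quasi-Leibniz quantum compact metric spaces if: its tunnels have domain and codomain in $\mathcal C$; any two elements of $\mathcal C$ are joined by a tunnel in $\mathcal T$; $\mathcal T$ is closed under inverses; for every full quantum isometry $h:(\mathfrak A,\mathsf L_{\mathfrak A})\to(\mathfrak B,\mathsf L_{\mathfrak B})$ between elements of $\mathcal C$ the tunnels $(\mathfrak A,\mathsf L_{\mathfrak A},\mathrm{id},h)$ and $(\mathfrak B,\mathsf L_{\mathfrak B},h^{-1},\mathrm{id})$ are in $\mathcal T$; and if $\tau,\gamma\in\mathcal T$ and the codomain of $\tau$ is the domain of $\gamma$ then for every $\varepsilon>0$ there is a tunnel in $\mathcal T$ from the domain of $\tau$ to the codomain of $\gamma$ of extent less than $\chi(\tau)+\chi(\gamma)+\varepsilon$. The *dual $\mathcal T$-propinquity* $\Lambda^*_{\mathcal T}$ between two elements of $\mathcal C$ is the infimum of the extents of the tunnels in $\mathcal T$ from the first to the second. **Hypotheses.** Let $F$ be admissible and let $\mathcal T$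 be appropriate for a nonempty class $\mathcal C$ of $F$-quasi-Leibniz quantum compact metric spaces. Let $\mathcal S$ be a small category with countable sets of objects and of morphisms; $d(s)$ and $c(s)$ denote the domain and codomain of a morphism $s$. For every object $x$ let $(\mathfrak A^x,\mathsf L^x)$ and $(\mathfrak A^x_n,\mathsf L^x_n)$, $n\in\mathbb N$, be elements of $\mathcal C$ with $\lim_{n\to\infty}\Lambda^*_{\mathcal T}((\mathfrak A^x_n,\mathsf L^x_n),(\mathfrak A^x,\mathsf L^x))=0$. For every morphism $s$ let $D(s)\in[0,\infty)$ and, for $n\in\mathbb N$, let $\varphi^s_n:(\mathfrak A^{d(s)}_n,\mathsf L^{d(s)}_n)\to(\mathfrak A^{c(s)}_n,\mathsf L^{c(s)}_n)$ be a Lipschitz linear map with $\|\varphi^s_n\|\le D(s)$ and $\mathsf L^{c(s)}_n\circ\varphi^s_n\le D(s)\,\mathsf L^{d(s)}_n$ on self-adjoint elements. Assume $\lim_n\mathsf{mkD}(\varphi^s_n\circ\varphi^t_n,\varphi^{s\circ t}_n)=0$ for all composable $s,t$, and $\lim_n\mathsf{mkD}(\varphi^u_n,\mathrm{id})=0$ for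 every identity morphism $u$. **Theorem.** There exist a functor $\Psi$ from $\mathcal S$ to the category whose objects are the elements of $\mathcal C$ and whose morphisms are the Lipschitz linear maps, a strictly increasing $j:\mathbb N\to\mathbb N$, and, for every object $x$ and $n\in\mathbb N$, a tunnel $\tau^x_n\in\mathcal T$ from $(\mathfrak A^x,\mathsf L^x)$ to $(\mathfrak A^x_n,\mathsf L^x_n)$, such that: * $\lim_{n\to\infty}\chi(\tau^x_n)=0$ and $\Psi(x)=(\mathfrak A^x,\mathsf L^x)$ for every object $x$; * $\|\Psi(s)\|\le\sqrt2\,D(s)$ and $\mathsf L^{c(s)}\circ\Psi(s)\le D(s)\,\mathsf L^{d(s)}$ on self-adjoint elements, for every morphism $s$; * for every morphism $s$, $a\in\mathrm{dom}(\mathsf L^{d(s)})$, $l\in[\mathsf L^{d(s)}(a),\infty)$ and $D\in[D(s),\infty)$, the forward target sets $$\mathfrak f_{s,n}(a|l,D)=\bigcup\left\{\mathfrak t_{(\tau^{c(s)}_n)^{-1}}\big(\varphi^s_n(b)\,\big|\,Dl\big): b\in\mathfrak t_{\tau^{d(s)}_n}(a|l)\right\}$$ are such that $\mathfrak f_{s,j(n)}(a|l,D)$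 converges to $\{\Psi(s)(a)\}$, as $n\to\infty$, in the Hausdorff distance of the norm of $\mathfrak A^{c(s)}$. Furthermore: 1. If $s$ is a morphism such that $\varphi^s_n$ is positive for all $n$, and $\{a\in\mathrm{dom}(\mathsf L^{d(s)}):a\ge0\}$ is dense in $\{a\in\mathfrak{sa}(\mathfrak A^{d(s)}):a\ge0\}$, then $\Psi(s)$ is positive. 2. If $s$ is a morphism such that $\varphi^s_n$ is a Lipschitz morphism for all $n$, then $\Psi(s)$ is a Lipschitz morphism, and in particular $\|\Psi(s)\|=1$. 3. If $s,s'$ are morphisms with $d(s)=d(s')$ and $c(s)=c(s')$, then $\mathsf{mkD}(\Psi(s),\Psi(s'))$ is a limit point of the sequence $(\mathsf{mkD}(\varphi^s_n,\varphi^{s'}_n))_{n\in\mathbb N}$, and so $$\liminf_{n\to\infty}\mathsf{mkD}(\varphi^s_n,\varphi^{s'}_n)\le\mathsf{mkD}(\Psi(s),\Psi(s'))\le\limsup_{n\to\infty}\mathsf{mkD}(\varphi^s_n,\varphi^{s'}_n).$$ If $d(s)=c(s)$, then also $\liminf_{n\to\infty}\mathsf{mk\ell}(\varphi^s_n)\le\mathsf{mk\ell}(\Psi(s))\le\limsup_{n\to\infty}\mathsf{mk\ell}(\varphi^s_n)$.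 -/

import Mathlib

open Filter Topology CategoryTheory
open scoped NNReal ENNReal

universe u v w

noncomputable section

namespace QuantumMetric

/-! ### States, Jordan and Lie products, positive elements -/

section CStar

variable {A : Type u} [CStarAlgebra A] {B : Type v} [CStarAlgebra B]

/-- The state space of a unital C*-algebra, with the topology induced by the weak* topology. -/
def StateSpace (A : Type u) [CStarAlgebra A] : Set (WeakDual ℂ A) :=
  {μ | μ 1 = 1 ∧ ∀ a : A, 0 ≤ (μ (star a * a)).re ∧ (μ (star a * a)).im = 0}

/-- The Jordan product `(ab + ba) / 2`. -/
def jordan (a b : A) : A := (2⁻¹ : ℂ) • (a * b + b * a)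

/-- The Lie product `(ab - ba) / 2i`. -/
def lie (a b : A) : A := ((2 * Complex.I)⁻¹ : ℂ) • (a * b - b * a)

/-- Positive elements of a C*-algebra. -/
def IsPos (a : A) : Prop := (CStarAlgebra.spectralOrder A).le 0 a

/-- The Monge–Kantorovich (extended) metric on states attached to `L : A → [0,∞]`. -/
def kantorovich (L : A → ℝ≥0∞) (μ ν : StateSpace A) : ℝ≥0∞ :=
  ⨆ (a : A) (_ : L a ≤ 1), edist (μ.1 a) (ν.1 a)

/-- The extended pseudometric structure on the state space given by `kantorovich L`, with the topology
generated by its balls. -/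
@[reducible] def mkEMetric (L : A → ℝ≥0∞) : PseudoEMetricSpace (StateSpace A) where
  edist := kantorovich L
  edist_self μ := by simp [kantorovich]
  edist_comm μ ν := by simp only [kantorovich, edist_comm]
  edist_triangle μ ν ρ := by
    refine iSup₂_le fun a ha => (edist_triangle _ (ν.1 a) _).trans (add_le_add ?_ ?_)
    · exact le_iSup₂_of_le (f := fun a (_ : L a ≤ 1) => edist (μ.1 a) (ν.1 a)) a ha le_rfl
    · exact le_iSup₂_of_le (f := fun a (_ : L a ≤ 1) => edist (ν.1 a) (ρ.1 a)) a ha le_rfl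

/-- The dual map `μ ↦ μ ∘ π` on states of a unital *-homomorphism. -/
def pullback (π : A →⋆ₐ[ℂ] B) (μ : StateSpace B) : StateSpace A :=
  ⟨(ContinuousLinearMap.comp (μ.1 : B →L[ℂ] ℂ)
      (⟨π.toAlgHom.toLinearMap, AddMonoidHomClass.continuous_of_bound π 1
        fun a => by simpa using NonUnitalStarAlgHom.norm_apply_le π a⟩ : A →L[ℂ] B) : A →L[ℂ] ℂ), by
    refine ⟨?_, fun a => ?_⟩
    · change μ.1 (π 1) = 1
      rw [map_one]; exact μ.2.1
    · change 0 ≤ (μ.1 (π (star a * a))).re ∧ (μ.1 (π (star a * a))).im = 0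
      rw [map_mul, map_star]; exact μ.2.2 (π a)⟩

end CStar

/-! ### Quasi-Leibniz quantum compact metric spaces -/

/-- Admissible functions `[0,∞]⁴ → [0,∞]`; they take finite values at finite arguments. -/
structure Admissible (F : ℝ≥0∞ → ℝ≥0∞ → ℝ≥0∞ → ℝ≥0∞ → ℝ≥0∞) : Prop where
  mono : ∀ {x x' y y' l l' m m'}, x ≤ x' → y ≤ y' → l ≤ l' → m ≤ m' → F x y l m ≤ F x' y' l' m'
  leibniz_le : ∀ x y l m : ℝ≥0, (x * m + y * l : ℝ≥0∞) ≤ F x y l m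
  finite : ∀ x y l m : ℝ≥0, F x y l m ≠ ⊤

/-- An `F`-quasi-Leibniz quantum compact metric space `(A, L)`. The L-seminorm is recorded as a
function `A → [0,∞]`, equal to `∞` outside of its domain, which is contained in the self-adjoint
part of `A`; thus `dom L = {a | L a < ∞}`. -/
structure QCMS (F : ℝ≥0∞ → ℝ≥0∞ → ℝ≥0∞ → ℝ≥0∞ → ℝ≥0∞) : Type (u + 1) where
  carrier : Type u
  [cstar : CStarAlgebra carrier]
  [nontrivial : Nontrivial carrier]
  L : carrier → ℝ≥0∞
  isSelfAdjoint_of_lt_top : ∀ a, L a < ⊤ → IsSelfAdjoint a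
  L_smul : ∀ (r : ℝ) a, L ((r : ℂ) • a) = ENNReal.ofReal |r| * L a
  L_add : ∀ a b, L (a + b) ≤ L a + L b
  dense_dom : ∀ a, IsSelfAdjoint a → a ∈ closure {b | L b < ⊤}
  jordan_mem_dom : ∀ a b, L a < ⊤ → L b < ⊤ → L (jordan a b) < ⊤
  lie_mem_dom : ∀ a b, L a < ⊤ → L b < ⊤ → L (lie a b) < ⊤
  L_eq_zero : ∀ a, L a = 0 ↔ ∃ r : ℝ, a = (r : ℂ) • (1 : carrier)
  mk_ne_top : ∀ μ ν : StateSpace carrier, kantorovich L μ ν ≠ ⊤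
  mk_metrizes : (mkEMetric L).toUniformSpace.toTopologicalSpace =
    (instTopologicalSpaceSubtype : TopologicalSpace (StateSpace carrier))
  quasiLeibniz : ∀ a b, L a < ⊤ → L b < ⊤ →
    max (L (jordan a b)) (L (lie a b)) ≤ F ‖a‖ₑ ‖b‖ₑ (L a) (L b)
  lsc : LowerSemicontinuousOn L {a | IsSelfAdjoint a}

variable {F : ℝ≥0∞ → ℝ≥0∞ → ℝ≥0∞ → ℝ≥0∞ → ℝ≥0∞}

instance : CoeSort (QCMS.{u} F) (Type u) := ⟨QCMS.carrier⟩

instance (A : QCMS.{u} F) : CStarAlgebra A := A.cstar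

instance (A : QCMS.{u} F) : Nontrivial A := A.nontrivial

/-- Lipschitz linear maps. -/
@[ext] structure LipMap (A B : QCMS.{u} F) where
  toCLM : A →L[ℂ] B
  map_one : toCLM 1 = 1
  map_dom : ∀ a, A.L a < ⊤ → B.L (toCLM a) < ⊤

/-- The identity as a Lipschitz linear map. -/
def LipMap.id (A : QCMS.{u} F) : LipMap A A where
  toCLM := ContinuousLinearMap.id ℂ A
  map_one := rfl
  map_dom _ h := h

/-- Composition of Lipschitz linear maps. -/
def LipMap.comp {A B C : QCMS.{u} F} (ψ : LipMap B C) (φ : LipMap A B) : LipMap A C where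
  toCLM := ψ.toCLM.comp φ.toCLM
  map_one := by
    rw [ContinuousLinearMap.comp_apply, φ.map_one, ψ.map_one]
  map_dom a h := ψ.map_dom _ (φ.map_dom a h)

/-- `φ` is a Lipschitz morphism: it is (also) a unital *-homomorphism. -/
def LipMap.IsMorphism {A B : QCMS.{u} F} (φ : LipMap A B) : Prop :=
  ∃ π : A →⋆ₐ[ℂ] B, ∀ a, π a = φ.toCLM a

/-- `φ` maps positive elements to positive elements. -/
def LipMap.IsPositive {A B : QCMS.{u} F} (φ : LipMap A B) : Prop :=
  ∀ a : A, IsPos a → IsPos (φ.toCLM a)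

/-- `L_B ∘ φ ≤ D L_A` on the self-adjoint part of `A`. -/
def LipMap.DilationLE {A B : QCMS.{u} F} (φ : LipMap A B) (D : ℝ≥0) : Prop :=
  ∀ a : A, IsSelfAdjoint a → B.L (φ.toCLM a) ≤ D * A.L a

/-- The Monge–Kantorovich distance between linear maps. -/
def mkDist {A B : QCMS.{u} F} (φ ψ : LipMap A B) : ℝ≥0∞ :=
  ⨆ (a : A) (_ : A.L a ≤ 1), edist (φ.toCLM a) (ψ.toCLM a)

/-- The Monge–Kantorovich length of a Lipschitz linear endomorphism. -/
def mkLength {A : QCMS.{u} F} (φ : LipMap A A) : ℝ≥0∞ := mkDist (LipMap.id A) φ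

/-- The objects of the category associated with a class of quantum compact metric spaces. -/
def ClassCat (𝒞 : Set (QCMS.{u} F)) : Type (u + 1) := {A : QCMS.{u} F // A ∈ 𝒞}

/-- An element of `𝒞`, as an object of the associated category. -/
def ClassCat.of {𝒞 : Set (QCMS.{u} F)} (A : QCMS.{u} F) (hA : A ∈ 𝒞) : ClassCat 𝒞 := ⟨A, hA⟩

/-- The category whose objects are the elements of `𝒞` and whose morphisms are the Lipschitz
linear maps. -/
instance (𝒞 : Set (QCMS.{u} F)) : Category.{u} (ClassCat 𝒞) where
  Hom A B := LipMap A.1 B.1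
  id A := LipMap.id A.1
  comp φ ψ := LipMap.comp ψ φ

/-- The Lipschitz linear map `Ψ(s) : A X → A Y` underlying the image of an arrow `s : X ⟶ Y` by a
functor `Ψ` whose value at each object `X` is `A X`. -/
def arrow {S : Type v} [Category.{w} S] {𝒞 : Set (QCMS.{u} F)} {A : S → QCMS.{u} F}
    {hA : ∀ X, A X ∈ 𝒞} (Ψ : S ⥤ ClassCat 𝒞) (hΨ : ∀ X, Ψ.obj X = ClassCat.of (A X) (hA X))
    {X Y : S} (s : X ⟶ Y) : LipMap (A X) (A Y) :=
  (eqToHom (hΨ X).symm ≫ Ψ.map s ≫ eqToHom (hΨ Y) :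
    ClassCat.of (A X) (hA X) ⟶ ClassCat.of (A Y) (hA Y))

/-! ### Tunnels and the dual propinquity -/

/-- Quantum isometries. -/
structure IsQuantumIsometry {D A : QCMS.{u} F} (π : D →⋆ₐ[ℂ] A) : Prop where
  surjective : Function.Surjective π
  L_eq : ∀ a : A, IsSelfAdjoint a → A.L a = ⨅ (d : D) (_ : π d = a), D.L d

/-- Full quantum isometries. -/
def IsFullQuantumIsometry {A B : QCMS.{u} F} (h : A ≃⋆ₐ[ℂ] B) : Prop :=
  ∀ a, B.L (h a) = A.L a

/-- An `F`-tunnel from `A` to `B`. -/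
structure Tunnel (A B : QCMS.{u} F) : Type (u + 1) where
  D : QCMS.{u} F
  dom : D →⋆ₐ[ℂ] A
  cod : D →⋆ₐ[ℂ] B
  dom_isometry : IsQuantumIsometry dom
  cod_isometry : IsQuantumIsometry cod

/-- The inverse tunnel. -/
def Tunnel.inv {A B : QCMS.{u} F} (τ : Tunnel A B) : Tunnel B A :=
  ⟨τ.D, τ.cod, τ.dom, τ.cod_isometry, τ.dom_isometry⟩

/-- The extent of a tunnel. -/
def Tunnel.extent {A B : QCMS.{u} F} (τ : Tunnel A B) : ℝ≥0∞ :=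
  letI := mkEMetric τ.D.L
  max (Metric.hausdorffEDist (Set.univ : Set (StateSpace τ.D)) (Set.range (pullback τ.dom)))
    (Metric.hausdorffEDist (Set.univ : Set (StateSpace τ.D)) (Set.range (pullback τ.cod)))

theorem IsFullQuantumIsometry.isQuantumIsometry {A B : QCMS.{u} F} {h : A ≃⋆ₐ[ℂ] B}
    (hh : IsFullQuantumIsometry h) : IsQuantumIsometry (h : A →⋆ₐ[ℂ] B) where
  surjective := h.surjective
  L_eq b _ := by
    refine le_antisymm (le_iInf₂ fun a ha => ?_) ?_
    · rw [← hh a]; exact (congrArg B.L ha).ge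
    · refine (iInf₂_le (h.symm b) (h.apply_symm_apply b)).trans ?_
      rw [← hh, h.apply_symm_apply]

theorem isQuantumIsometry_id (A : QCMS.{u} F) : IsQuantumIsometry (StarAlgHom.id ℂ A) where
  surjective a := ⟨a, rfl⟩
  L_eq a _ := le_antisymm (le_iInf₂ fun _ hb => (congrArg A.L hb).ge) 
    (iInf₂_le (f := fun d (_ : StarAlgHom.id ℂ A d = a) => A.L d) a rfl)

theorem IsFullQuantumIsometry.symm {A B : QCMS.{u} F} {h : A ≃⋆ₐ[ℂ] B}
    (hh : IsFullQuantumIsometry h) : IsFullQuantumIsometry h.symm := fun b => by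
  rw [← hh, h.apply_symm_apply]

/-- The tunnel `(A, L_A, id, h)` for a full quantum isometry `h : A → B`. -/
def Tunnel.ofIsometry {A B : QCMS.{u} F} (h : A ≃⋆ₐ[ℂ] B) (hh : IsFullQuantumIsometry h) :
    Tunnel A B :=
  ⟨A, StarAlgHom.id ℂ A, h, isQuantumIsometry_id A, hh.isQuantumIsometry⟩

/-- The tunnel `(B, L_B, h⁻¹, id)` for a full quantum isometry `h : A → B`. -/
def Tunnel.ofIsometrySymm {A B : QCMS.{u} F} (h : A ≃⋆ₐ[ℂ] B) (hh : IsFullQuantumIsometry h) :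
    Tunnel A B :=
  ⟨B, h.symm, StarAlgHom.id ℂ B, hh.symm.isQuantumIsometry, isQuantumIsometry_id B⟩

/-- A class of tunnels, given by the tunnels it contains between any two spaces. -/
def TunnelClass (F : ℝ≥0∞ → ℝ≥0∞ → ℝ≥0∞ → ℝ≥0∞ → ℝ≥0∞) : Type (u + 1) :=
  ∀ A B : QCMS.{u} F, Set (Tunnel A B)

/-- The class `𝒯` of tunnels is appropriate for the nonempty class `𝒞`. -/
structure Appropriate (𝒯 : TunnelClass.{u} F) (𝒞 : Set (QCMS.{u} F)) : Prop where
  nonempty : 𝒞.Nonempty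
  mem : ∀ {A B} {τ : Tunnel A B}, τ ∈ 𝒯 A B → A ∈ 𝒞 ∧ B ∈ 𝒞
  exists_tunnel : ∀ {A B}, A ∈ 𝒞 → B ∈ 𝒞 → (𝒯 A B).Nonempty
  inv_mem : ∀ {A B} {τ : Tunnel A B}, τ ∈ 𝒯 A B → τ.inv ∈ 𝒯 B A
  isometry_mem : ∀ {A B}, A ∈ 𝒞 → B ∈ 𝒞 →
    ∀ (h : A ≃⋆ₐ[ℂ] B) (hh : IsFullQuantumIsometry h),
      Tunnel.ofIsometry h hh ∈ 𝒯 A B ∧ Tunnel.ofIsometrySymm h hh ∈ 𝒯 A B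
  comp : ∀ {A B C} {τ : Tunnel A B} {γ : Tunnel B C}, τ ∈ 𝒯 A B → γ ∈ 𝒯 B C →
    ∀ ε : ℝ≥0, 0 < ε → ∃ σ ∈ 𝒯 A C, σ.extent < τ.extent + γ.extent + ε

/-- The dual `𝒯`-propinquity. -/
def propinquity (𝒯 : TunnelClass.{u} F) (A B : QCMS.{u} F) : ℝ≥0∞ :=
  ⨅ τ ∈ 𝒯 A B, Tunnel.extent τ

/-- The `l`-target set of `a` for the tunnel `τ`. -/
def targetSet {A B : QCMS.{u} F} (τ : Tunnel A B) (a : A) (l : ℝ≥0) : Set B :=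
  {b | ∃ d : τ.D, IsSelfAdjoint d ∧ τ.D.L d ≤ l ∧ τ.dom d = a ∧ τ.cod d = b}

/-- The `(l, D)`-forward target set of `a`, that is, the union of the `D l`-target sets for `γ` of
the elements of the image by `φ` of the `l`-target set of `a` for `τ`. -/
def forwardTargetSet {A B E G : QCMS.{u} F} (τ : Tunnel A E) (φ : LipMap E G) (γ : Tunnel G B)
    (a : A) (l D : ℝ≥0) : Set B :=
  ⋃ c ∈ φ.toCLM '' targetSet τ a l, targetSet γ c (D * l)

end QuantumMetric

end

open QuantumMetric

/-! A sequence `x n` in the approximating spaces converges to `a` (`Lim`) if it is norm-asymptotic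
to images of lifts `d n` in the tunnels whose other images tend to `a`, where the real and imaginary
parts of `d n` have uniformly bounded norm and L-seminorm. Bounded L-seminorm and small extent make
both quotient maps of a tunnel nearly isometric on self-adjoint lifts (`norm_le_norm_map_add`). The
quasi-Leibniz inequality keeps `star d * d` bounded, so the C*-identity extends this to all bounded
lifts (`Tunnel.exists_norm_sq_le`). Hence norms pass to the limit (`Lim.tendsto_norm`), limits are
unique, and they respect sums, scalars and products.

The limit of the maps `φ n` is first a graph: pairs of a limit of some `x n` and a limit of `φ n (x
n)`. The uniform bound on the norms of `φ n` passes to this graph, so once its first projection is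
dense the graph extends to a bounded operator (`exists_converges`). Since `Lim.tendsto_norm` also
covers elements that are not self-adjoint, the constant obtained is `D s`, without the factor `√2`.

Existence is compactness. Sets bounded in L and in norm are compact, by Arzelà–Ascoli on the state
space (`isCompact_setOf_L_le_norm_le`), and forward targets lie in such sets. Choosing them over a
countable dense subset of each domain gives one subsequence `j` along which all of them converge; an
equicontinuity estimate extends the convergence to the whole domain (`exists_subseq_converges`). The
subsequence is carried as the filter `map j atTop`.

Functoriality, positivity and multiplicativity then follow by passing relations between the `φ n` to
the limit. For the Monge–Kantorovich distance, one inequality tests a single element, and the other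
extracts a limit of near-maximizers by compactness (`Converges.tendsto_mkDist`). -/

noncomputable section

namespace QuantumMetric

/-! ### States: positivity through norms, weak* compactness, norming self-adjoint elements -/

section States

variable {A : Type u} [CStarAlgebra A]

theorem isPos_iff_exists_star_mul_self {a : A} : IsPos a ↔ ∃ c : A, a = star c * c := by
  let := CStarAlgebra.spectralOrder A
  have := CStarAlgebra.spectralOrderedRing A
  exact CStarAlgebra.nonneg_iff_eq_star_mul_self

theorem isPos_norm_sub {a : A} (ha : IsSelfAdjoint a) : IsPos (((‖a‖ : ℝ) : ℂ) • (1 : A) - a) := by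
  let := CStarAlgebra.spectralOrder A
  have := CStarAlgebra.spectralOrderedRing A
  have h := ha.le_algebraMap_norm_self
  have h' : (0 : A) ≤ ((‖a‖ : ℝ) : ℂ) • (1 : A) - a := by
    rw [sub_nonneg]
    simpa [Algebra.algebraMap_eq_smul_one] using h
  exact h'

theorem IsPos.isSelfAdjoint {a : A} (ha : IsPos a) : IsSelfAdjoint a := by
  obtain ⟨c, rfl⟩ := isPos_iff_exists_star_mul_self.1 ha
  exact IsSelfAdjoint.star_mul_self c

/-- Here `0 ≤ r - a ≤ r`. With the next lemma this turns positivity into a norm condition, which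
survives limits through tunnels, where the order itself is not directly visible. -/
theorem IsPos.norm_norm_sub_le {a : A} (ha : IsPos a) {r : ℝ} (hr : ‖a‖ ≤ r) :
    ‖(r : ℂ) • (1 : A) - a‖ ≤ r := by
  let := CStarAlgebra.spectralOrder A
  have := CStarAlgebra.spectralOrderedRing A
  have ha0 : (0 : A) ≤ a := ha
  have h1 : a ≤ algebraMap ℝ A r := by
    refine (IsSelfAdjoint.le_algebraMap_norm_self ha.isSelfAdjoint).trans ?_
    exact algebraMap_mono A hr
  have h0 : 0 ≤ r := (norm_nonneg a).trans hr
  have e : (r : ℂ) • (1 : A) = algebraMap ℝ A r := by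
    simp [Algebra.algebraMap_eq_smul_one]
  rw [e]
  rw [CStarAlgebra.norm_le_iff_le_algebraMap _ h0 (sub_nonneg.2 h1)]
  exact sub_le_self _ ha0

theorem isPos_add_of_norm_sub_le {a : A} (ha : IsSelfAdjoint a) {r t : ℝ}
    (h : ‖(r : ℂ) • (1 : A) - a‖ ≤ r + t) : IsPos (a + (t : ℂ) • (1 : A)) := by
  let := CStarAlgebra.spectralOrder A
  have := CStarAlgebra.spectralOrderedRing A
  have e : ∀ r : ℝ, (r : ℂ) • (1 : A) = algebraMap ℝ A r := fun r => by
    simp [Algebra.algebraMap_eq_smul_one]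
  rw [e] at h
  have hs : IsSelfAdjoint (algebraMap ℝ A r - a) := (IsSelfAdjoint.algebraMap A (.all r)).sub ha
  have h1 := (IsSelfAdjoint.le_algebraMap_norm_self hs).trans (algebraMap_mono A h)
  have h2 : (0 : A) ≤ a + (t : ℂ) • (1 : A) := by
    rw [e, ← sub_nonneg] at *
    rw [map_add] at h1
    simpa [add_comm] using h1
  exact h2

theorem StateSpace.apply_one (μ : StateSpace A) : μ.1 1 = 1 := μ.2.1

theorem StateSpace.apply_of_isPos (μ : StateSpace A) {a : A} (ha : IsPos a) :
    0 ≤ (μ.1 a).re ∧ (μ.1 a).im = 0 := by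
  obtain ⟨c, rfl⟩ := isPos_iff_exists_star_mul_self.1 ha
  exact μ.2.2 c

theorem StateSpace.apply_im (μ : StateSpace A) {a : A} (ha : IsSelfAdjoint a) :
    (μ.1 a).im = 0 := by
  have h := (StateSpace.apply_of_isPos μ (isPos_norm_sub ha)).2
  rw [map_sub, map_smul, StateSpace.apply_one μ] at h
  simpa using h

theorem StateSpace.apply_re_le (μ : StateSpace A) {a : A} (ha : IsSelfAdjoint a) :
    (μ.1 a).re ≤ ‖a‖ := by
  have h := (StateSpace.apply_of_isPos μ (isPos_norm_sub ha)).1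
  rw [map_sub, map_smul, StateSpace.apply_one μ] at h
  simpa using h

theorem StateSpace.norm_apply_le (μ : StateSpace A) {a : A} (ha : IsSelfAdjoint a) :
    ‖μ.1 a‖ ≤ ‖a‖ := by
  have h1 := StateSpace.apply_re_le μ ha
  have h2 := StateSpace.apply_re_le μ ha.neg
  rw [map_neg, norm_neg] at h2
  have h3 : μ.1 a = ((μ.1 a).re : ℂ) := Complex.ext rfl (by simp [StateSpace.apply_im μ ha])
  rw [h3, Complex.norm_real, Real.norm_eq_abs, abs_le]
  simp only [Complex.neg_re] at h2
  constructor <;> linarith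

theorem StateSpace.norm_apply_le_two_mul (μ : StateSpace A) (a : A) : ‖μ.1 a‖ ≤ 2 * ‖a‖ := by
  have h := realPart_add_I_smul_imaginaryPart a
  have h1 := StateSpace.norm_apply_le μ (realPart a).2
  have h2 := StateSpace.norm_apply_le μ (imaginaryPart a).2
  have h3 := realPart.norm_le a
  have h4 := imaginaryPart.norm_le a
  calc ‖μ.1 a‖ = ‖μ.1 ((realPart a : A) + Complex.I • (imaginaryPart a : A))‖ := by rw [h]
    _ ≤ ‖μ.1 (realPart a : A)‖ + ‖μ.1 (imaginaryPart a : A)‖ := by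
      rw [map_add, map_smul]
      refine (norm_add_le _ _).trans ?_
      rw [norm_smul]; simp
    _ ≤ 2 * ‖a‖ := by
      have h5 : ‖(realPart a : A)‖ ≤ ‖a‖ := h3
      have h6 : ‖(imaginaryPart a : A)‖ ≤ ‖a‖ := h4
      linarith

theorem isCompact_stateSpace : IsCompact (StateSpace A) := by
  refine WeakDual.isCompact_of_bounded_of_closed ?_ ?_
  · refine (Metric.isBounded_closedBall (x := (0 : StrongDual ℂ A)) (r := 2)).subset ?_
    intro μ hμ
    rw [mem_closedBall_zero_iff]
    exact ContinuousLinearMap.opNorm_le_bound _ (by norm_num)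
      fun a => StateSpace.norm_apply_le_two_mul ⟨_, hμ⟩ a
  · have e : StateSpace A = {μ : WeakDual ℂ A | μ 1 = 1} ∩
        ⋂ a : A, {μ : WeakDual ℂ A | 0 ≤ (μ (star a * a)).re ∧ (μ (star a * a)).im = 0} := by
      ext μ; simp [StateSpace]
    rw [e]
    refine (isClosed_eq (WeakDual.eval_continuous 1) continuous_const).inter
      (isClosed_iInter fun a => ?_)
    exact (isClosed_le continuous_const
      (Complex.continuous_re.comp (WeakDual.eval_continuous _))).inter
      (isClosed_eq (Complex.continuous_im.comp (WeakDual.eval_continuous _)) continuous_const)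

instance : CompactSpace (StateSpace A) := isCompact_iff_compactSpace.1 isCompact_stateSpace

/-- A unital functional of norm at most one is a state. -/
theorem mem_stateSpace_of_norm_le_one [Nontrivial A] (f : StrongDual ℂ A) (h1 : f 1 = 1)
    (hf : ‖f‖ ≤ 1) : (f : WeakDual ℂ A) ∈ StateSpace A := by
  have hle : ∀ b, ‖f b‖ ≤ ‖b‖ := fun b => by simpa using f.le_of_opNorm_le hf b
  have him : ∀ b : A, IsSelfAdjoint b → (f b).im = 0 := by
    intro b hb
    -- Evaluate `f` at `b + i t`: its squared norm is at most `‖b‖² + t²` by the C*-identity, while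
    -- the imaginary part of its value is `Im f(b) + t`. Letting `t` vary forces `Im f(b) = 0`.
    have key : ∀ t : ℝ, ((f b).im + t) ^ 2 ≤ ‖b‖ ^ 2 + t ^ 2 := by
      intro t
      have e1 : ‖b + (t * Complex.I : ℂ) • (1 : A)‖ ^ 2 ≤ ‖b‖ ^ 2 + t ^ 2 := by
        have hs : star (b + (t * Complex.I : ℂ) • (1 : A)) * (b + (t * Complex.I : ℂ) • (1 : A))
            = b * b + ((t ^ 2 : ℝ) : ℂ) • (1 : A) := by
          have hm : (t * Complex.I : ℂ) * (t * Complex.I) = -((t ^ 2 : ℝ) : ℂ) := by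
            rw [mul_mul_mul_comm, Complex.I_mul_I]; push_cast; ring
          simp only [star_add, star_smul, hb.star_eq, star_one, star_mul', RCLike.star_def,
            Complex.conj_ofReal, Complex.conj_I, mul_neg, add_mul, mul_add, mul_one, one_mul,
            smul_mul_assoc, mul_smul_comm, neg_smul, neg_mul]
          rw [smul_add, smul_neg, smul_smul, hm]
          simp only [neg_smul, neg_neg]
          abel
        rw [sq, ← CStarRing.norm_star_mul_self, hs]
        refine (norm_add_le _ _).trans ?_
        gcongr
        · rw [sq]; exact norm_mul_le _ _
        · rw [norm_smul, norm_one, mul_one, Complex.norm_real, Real.norm_eq_abs, abs_sq]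
      have e2 : ((f b).im + t) ^ 2 ≤ ‖f (b + (t * Complex.I : ℂ) • (1 : A))‖ ^ 2 := by
        have : (f (b + (t * Complex.I : ℂ) • (1 : A))).im = (f b).im + t := by
          rw [map_add, map_smul, h1]; simp
        rw [← this, ← sq_abs]
        gcongr
        exact Complex.abs_im_le_norm _
      refine e2.trans (le_trans ?_ e1)
      gcongr
      exact hle _
    by_contra hne
    -- This `t` makes the cross term `2 t Im f(b)` equal to `‖b‖² + 1`, which is too large.
    have := key ((‖b‖ ^ 2 + 1) / (2 * (f b).im))
    have hy : 0 < (f b).im ^ 2 := by positivity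
    have e : 2 * (f b).im * ((‖b‖ ^ 2 + 1) / (2 * (f b).im)) = ‖b‖ ^ 2 + 1 := by
      field_simp
    nlinarith
  refine ⟨h1, fun a => ?_⟩
  have hp : IsPos (star a * a) := isPos_iff_exists_star_mul_self.2 ⟨a, rfl⟩
  refine ⟨?_, him _ hp.isSelfAdjoint⟩
  have h2 := (hle _).trans (hp.norm_norm_sub_le le_rfl)
  rw [map_sub, map_smul, h1] at h2
  have h3 := (Complex.re_le_norm _).trans h2
  simp only [smul_eq_mul, mul_one, Complex.sub_re, Complex.ofReal_re] at h3
  have : 0 ≤ (f (star a * a)).re := by linarith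
  exact this

/-- The shift `a + 1` has norm `‖a‖ + 1`. A norm-one functional attaining that norm must have `f 1 =
1` and `f a = ‖a‖`, and being unital of norm one it is a state. -/
theorem exists_state_apply_eq_norm [Nontrivial A] {a : A} (hs : ‖a‖ ∈ spectrum ℝ a) :
    ∃ μ : StateSpace A, μ.1 a = (‖a‖ : ℂ) := by
  set b : A := a + algebraMap ℝ A 1 with hb
  have hbn : ‖b‖ = ‖a‖ + 1 := by
    apply le_antisymm
    · refine (norm_add_le _ _).trans ?_
      simp
    · have : ‖a‖ + 1 ∈ spectrum ℝ b := by
        rw [hb, add_comm a]; exact spectrum.add_mem_add_iff.2 hs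
      have := spectrum.norm_le_norm_of_mem this
      rwa [Real.norm_of_nonneg (by positivity)] at this
  obtain ⟨f, hf, hfb⟩ := exists_dual_vector ℂ b (by rw [hbn]; exact (by positivity : 0 < ‖a‖ + 1).ne')
  have hfe : f a + f 1 = (‖a‖ : ℂ) + 1 := by
    have : f b = f a + f 1 := by rw [hb]; simp
    rw [← this, hfb, hbn]; simp
  have ha : ‖f a‖ ≤ ‖a‖ := by simpa using f.le_of_opNorm_le hf.le a
  have h1 : ‖f 1‖ ≤ 1 := by simpa using f.le_of_opNorm_le hf.le 1
  have hre := congrArg Complex.re hfe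
  have him := congrArg Complex.im hfe
  have hra := Complex.re_le_norm (f a)
  have hr1 := Complex.re_le_norm (f 1)
  simp only [Complex.add_re, Complex.ofReal_re, Complex.one_re] at hre
  have e1 : (f 1).re = 1 := by linarith
  have e2 : f 1 = 1 := by
    refine Complex.ext (by simp [e1]) ?_
    have h := Complex.sq_norm (f 1)
    rw [Complex.normSq_apply, e1] at h
    have : ‖f 1‖ ^ 2 ≤ 1 := by nlinarith [norm_nonneg (f 1)]
    have : (f 1).im * (f 1).im ≤ 0 := by linarith
    simpa using le_antisymm this (mul_self_nonneg _)
  refine ⟨⟨_, mem_stateSpace_of_norm_le_one f e2 hf.le⟩, ?_⟩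
  rw [e2] at hfe
  exact add_right_cancel hfe

theorem exists_state_norm_apply_eq_norm [Nontrivial A] {a : A} (ha : IsSelfAdjoint a) :
    ∃ μ : StateSpace A, ‖μ.1 a‖ = ‖a‖ := by
  rcases CStarAlgebra.norm_or_neg_norm_mem_spectrum ha with h | h
  · obtain ⟨μ, hμ⟩ := exists_state_apply_eq_norm h
    exact ⟨μ, by simp [hμ]⟩
  · have h' : ‖-a‖ ∈ spectrum ℝ (-a) := by
      rw [← spectrum.neg_eq, norm_neg]; simpa using h
    obtain ⟨μ, hμ⟩ := exists_state_apply_eq_norm h'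
    refine ⟨μ, ?_⟩
    rw [← norm_neg, ← map_neg, hμ]; simp

theorem norm_le_of_forall_state [Nontrivial A] {a : A} (ha : IsSelfAdjoint a) {r : ℝ}
    (h : ∀ μ : StateSpace A, ‖μ.1 a‖ ≤ r) : ‖a‖ ≤ r := by
  obtain ⟨μ, hμ⟩ := exists_state_norm_apply_eq_norm ha
  exact hμ ▸ h μ

instance [Nontrivial A] : Nonempty (StateSpace A) :=
  ⟨(exists_state_norm_apply_eq_norm (IsSelfAdjoint.zero A)).choose⟩

end States

variable {F : ℝ≥0∞ → ℝ≥0∞ → ℝ≥0∞ → ℝ≥0∞ → ℝ≥0∞}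

theorem continuous_edist_left {X : Type*} [PseudoEMetricSpace X] (x : X) :
    Continuous fun y => edist x y := continuous_const.edist continuous_id

/-! ### L-seminorms: Lipschitz estimates on states and compactness of balls -/

section LSeminorm

variable (A : QCMS.{u} F)

theorem QCMS.L_scalar (r : ℝ) : A.L ((r : ℂ) • (1 : A)) = 0 := (A.L_eq_zero _).2 ⟨r, rfl⟩

theorem QCMS.L_one : A.L 1 = 0 := (A.L_eq_zero _).2 ⟨1, by simp⟩

theorem QCMS.L_zero : A.L 0 = 0 := (A.L_eq_zero _).2 ⟨0, by simp⟩

theorem QCMS.L_neg (a : A) : A.L (-a) = A.L a := by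
  have := A.L_smul (-1) a
  simpa using this

theorem QCMS.L_sub_le (a b : A) : A.L (a - b) ≤ A.L a + A.L b := by
  rw [sub_eq_add_neg, ← A.L_neg b]; exact A.L_add _ _

theorem QCMS.L_sub_scalar_le (a : A) (r : ℝ) : A.L (a - (r : ℂ) • (1 : A)) ≤ A.L a :=
  (A.L_sub_le a _).trans (by rw [A.L_scalar, add_zero])

variable {A}

theorem QCMS.isSelfAdjoint_of_le {a : A} {l : ℝ≥0} (h : A.L a ≤ l) : IsSelfAdjoint a :=
  A.isSelfAdjoint_of_lt_top a (h.trans_lt ENNReal.coe_lt_top)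

theorem QCMS.add_le {a b : A} {l m : ℝ≥0} (ha : A.L a ≤ l) (hb : A.L b ≤ m) :
    A.L (a + b) ≤ (l + m : ℝ≥0) := by
  rw [ENNReal.coe_add]; exact (A.L_add a b).trans (add_le_add ha hb)

theorem QCMS.sub_le {a b : A} {l m : ℝ≥0} (ha : A.L a ≤ l) (hb : A.L b ≤ m) :
    A.L (a - b) ≤ (l + m : ℝ≥0) := by
  rw [ENNReal.coe_add]; exact (A.L_sub_le a b).trans (add_le_add ha hb)

theorem QCMS.smul_le {a : A} {l : ℝ≥0} (ha : A.L a ≤ l) (r : ℝ) :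
    A.L ((r : ℂ) • a) ≤ (‖r‖₊ * l : ℝ≥0) := by
  rw [A.L_smul, ENNReal.coe_mul]
  gcongr
  rw [← Real.norm_eq_abs, ofReal_norm]; rfl

theorem edist_state_le {a : A} {l : ℝ≥0} (ha : A.L a ≤ l) (μ ν : StateSpace A) :
    edist (μ.1 a) (ν.1 a) ≤ l * kantorovich A.L μ ν := by
  -- For `l = 0` normalization is impossible, but then `a` is a scalar, on which all states agree.
  rcases eq_or_ne l 0 with rfl | hl
  · obtain ⟨r, rfl⟩ := (A.L_eq_zero a).1 (by simpa using ha)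
    rw [map_smul, map_smul, StateSpace.apply_one, StateSpace.apply_one]; simp
  · have h1 : A.L ((((l⁻¹ : ℝ≥0) : ℝ) : ℂ) • a) ≤ 1 := by
      have := QCMS.smul_le ha ((l⁻¹ : ℝ≥0) : ℝ)
      have e : ‖((l⁻¹ : ℝ≥0) : ℝ)‖₊ * l = 1 := by simp [hl]
      rwa [e] at this
    have h2 : edist (μ.1 ((((l⁻¹ : ℝ≥0) : ℝ) : ℂ) • a)) (ν.1 ((((l⁻¹ : ℝ≥0) : ℝ) : ℂ) • a)) ≤
        kantorovich A.L μ ν :=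
      le_iSup₂_of_le (f := fun a (_ : A.L a ≤ 1) => edist (μ.1 a) (ν.1 a)) _ h1 le_rfl
    have e : ∀ μ : StateSpace A, μ.1 a = (l : ℝ) • μ.1 ((((l⁻¹ : ℝ≥0) : ℝ) : ℂ) • a) := fun μ => by
      rw [map_smul, Complex.coe_smul, smul_smul]
      simp [hl]
    rw [e μ, e ν, edist_smul₀]
    have : ‖(l : ℝ)‖₊ = l := by simp
    rw [this, ENNReal.smul_def, smul_eq_mul]
    gcongr

/-- Lower semicontinuity is only assumed on the self-adjoint part; that part is closed and contains
the sublevel set. -/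
theorem isClosed_setOf_L_le (l : ℝ≥0) : IsClosed {a : A | A.L a ≤ l} := by
  have h := (lowerSemicontinuousOn_iff_preimage_Iic.1 A.lsc) (l : ℝ≥0∞)
  obtain ⟨v, hv, he⟩ := h
  have hsa : IsClosed {a : A | IsSelfAdjoint a} :=
    isClosed_eq continuous_star continuous_id
  have : {a : A | A.L a ≤ l} = {a : A | IsSelfAdjoint a} ∩ v := by
    rw [← he]; ext a
    simp only [Set.mem_ofPred_eq, Set.mem_inter_iff, Set.mem_preimage, Set.mem_Iic]
    exact ⟨fun h => ⟨QCMS.isSelfAdjoint_of_le h, h⟩, fun h => h.2⟩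
  rw [this]
  exact hsa.inter hv

/-- The distance to a fixed state `μ₀` is continuous because the metric induces the weak* topology,
so it has a finite maximum `R` on the compact state space. The scalar is `μ₀ a`. -/
theorem exists_norm_sub_scalar_le (A : QCMS.{u} F) :
    ∃ R : ℝ≥0, ∀ (l : ℝ≥0) (a : A), A.L a ≤ l → ∃ t : ℝ, ‖a - (t : ℂ) • (1 : A)‖ ≤ l * R := by
  obtain ⟨μ₀⟩ := (inferInstance : Nonempty (StateSpace A))
  have hcont : Continuous (fun μ : StateSpace A => kantorovich A.L μ₀ μ) := by
    have : @Continuous _ _ (mkEMetric A.L).toUniformSpace.toTopologicalSpace _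
        (fun μ : StateSpace A => kantorovich A.L μ₀ μ) :=
      @continuous_edist_left _ (mkEMetric A.L) μ₀
    rwa [A.mk_metrizes] at this
  obtain ⟨ν, -, hν⟩ := isCompact_univ.exists_isMaxOn (Set.univ_nonempty (α := StateSpace A))
    hcont.continuousOn
  refine ⟨(kantorovich A.L μ₀ ν).toNNReal, fun l a ha => ⟨(μ₀.1 a).re, ?_⟩⟩
  have hsa := QCMS.isSelfAdjoint_of_le ha
  have hre : (((μ₀.1 a).re : ℝ) : ℂ) = μ₀.1 a :=
    Complex.ext rfl (by simp [StateSpace.apply_im μ₀ hsa])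
  refine norm_le_of_forall_state
    (hsa.sub (QCMS.isSelfAdjoint_of_le (l := 0) (A.L_scalar _).le)) fun μ => ?_
  rw [map_sub, map_smul, StateSpace.apply_one, hre, smul_eq_mul, mul_one, ← dist_eq_norm,
    dist_comm, dist_edist]
  have h1 : edist (μ₀.1 a) (μ.1 a) ≤ l * (kantorovich A.L μ₀ ν) :=
    (edist_state_le ha μ₀ μ).trans (mul_le_mul_right (hν (Set.mem_univ μ)) _)
  rw [← ENNReal.coe_toNNReal (A.mk_ne_top μ₀ ν), ← ENNReal.coe_mul] at h1
  simpa using ENNReal.toReal_mono ENNReal.coe_ne_top h1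

/-- Evaluation embeds the set isometrically into the continuous functions on the state space. The
bound on L makes the image equi-Lipschitz for the Monge–Kantorovich metric, so Arzelà–Ascoli
applies. -/
theorem isCompact_setOf_L_le_norm_le (l : ℝ≥0) (r : ℝ) :
    IsCompact {a : A | A.L a ≤ l ∧ ‖a‖ ≤ r} := by
  set K : Set A := {a : A | A.L a ≤ l ∧ ‖a‖ ≤ r} with hK
  have hclosed : IsClosed K := (isClosed_setOf_L_le l).inter (isClosed_le continuous_norm continuous_const)
  have hsa : ∀ a ∈ K, IsSelfAdjoint a := fun a ha => QCMS.isSelfAdjoint_of_le ha.1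
  let g : K → BoundedContinuousFunction (StateSpace A) ℂ := fun a =>
    BoundedContinuousFunction.mkOfCompact
      ⟨fun μ => μ.1 a.1, (WeakDual.eval_continuous a.1).comp continuous_subtype_val⟩
  have hg : Isometry g := by
    refine Isometry.of_dist_eq fun a b => le_antisymm ?_ ?_
    · refine (BoundedContinuousFunction.dist_le dist_nonneg).2 fun μ => ?_
      change dist (μ.1 a.1) (μ.1 b.1) ≤ _
      rw [dist_eq_norm, ← map_sub, Subtype.dist_eq, dist_eq_norm]
      exact StateSpace.norm_apply_le μ ((hsa _ a.2).sub (hsa _ b.2))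
    · rw [Subtype.dist_eq, dist_eq_norm]
      refine norm_le_of_forall_state ((hsa _ a.2).sub (hsa _ b.2)) fun μ => ?_
      rw [map_sub, ← dist_eq_norm]
      exact BoundedContinuousFunction.dist_coe_le_dist (f := g a) (g := g b) μ
  have hcomp : CompleteSpace K := hclosed.completeSpace_coe
  have hc : IsCompact (closure (Set.range g)) := by
    refine BoundedContinuousFunction.arzela_ascoli (Metric.closedBall (0 : ℂ) r)
      (isCompact_closedBall _ _) _ ?_ ?_
    · rintro _ μ ⟨a, rfl⟩
      rw [mem_closedBall_zero_iff]
      exact (StateSpace.norm_apply_le μ (hsa _ a.2)).trans a.2.2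
    · intro μ₀
      rw [Metric.equicontinuousAt_iff_right]
      intro ε hε
      -- Dividing by `l + 1` rather than `l` also covers `l = 0`.
      have hnhds : {μ : StateSpace A | kantorovich A.L μ₀ μ < ENNReal.ofReal (ε / (l + 1))} ∈ 𝓝 μ₀ := by
        rw [← A.mk_metrizes]
        let := mkEMetric A.L
        have := Metric.eball_mem_nhds μ₀ (ε := ENNReal.ofReal (ε / (l + 1)))
          (by simpa using by positivity)
        refine mem_of_superset this fun μ hμ => ?_
        rw [Metric.mem_eball, edist_comm] at hμ
        exact hμ
      filter_upwards [hnhds] with μ hμ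
      rintro ⟨_, a, rfl⟩
      change dist (μ₀.1 a.1) (μ.1 a.1) < ε
      have h1 : edist (μ₀.1 a.1) (μ.1 a.1) ≤ ENNReal.ofReal (l * (ε / (l + 1))) := by
        refine (edist_state_le a.2.1 μ₀ μ).trans ?_
        rw [ENNReal.ofReal_mul l.coe_nonneg, ENNReal.ofReal_coe_nnreal]
        gcongr
      rw [edist_dist, ENNReal.ofReal_le_ofReal_iff (by positivity)] at h1
      refine h1.trans_lt ?_
      rw [mul_div_assoc', div_lt_iff₀ (by positivity)]
      nlinarith [l.coe_nonneg]
  have hemb := hg.isClosedEmbedding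
  have huniv : IsCompact (Set.univ : Set K) := by
    have := hemb.isCompact_preimage hc
    rwa [Set.preimage_eq_univ_iff.2 subset_closure] at this
  rw [isCompact_iff_compactSpace]
  exact ⟨huniv⟩

theorem isSeparable_dom (A : QCMS.{u} F) : TopologicalSpace.IsSeparable {a : A | A.L a < ⊤} := by
  have : {a : A | A.L a < ⊤} ⊆ ⋃ n : ℕ, {a : A | A.L a ≤ ((n : ℝ≥0) : ℝ≥0∞) ∧ ‖a‖ ≤ (n : ℝ)} := by
    intro a ha
    obtain ⟨n, hn⟩ := exists_nat_ge (max (A.L a).toReal ‖a‖)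
    refine Set.mem_iUnion.2 ⟨n, ?_, (le_max_right _ _).trans hn⟩
    have h1 := (le_max_left _ _).trans hn
    rw [← ENNReal.ofReal_toReal (ne_of_lt ha)]
    refine (ENNReal.ofReal_le_ofReal h1).trans ?_
    simp
  exact (TopologicalSpace.IsSeparable.iUnion fun n : ℕ =>
    (isCompact_setOf_L_le_norm_le (n : ℝ≥0) n).isSeparable).mono this

end LSeminorm

/-! ### Tunnels: optimal lifts and almost isometric quotients -/

section Tunnels

variable {A B D : QCMS.{u} F}

theorem IsQuantumIsometry.L_map_le {π : D →⋆ₐ[ℂ] A} (hπ : IsQuantumIsometry π) (d : D) :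
    A.L (π d) ≤ D.L d := by
  rcases eq_or_ne (D.L d) ⊤ with h | h
  · rw [h]; exact le_top
  · have hd : IsSelfAdjoint d := D.isSelfAdjoint_of_lt_top d h.lt_top
    rw [hπ.L_eq _ (hd.map π)]
    exact iInf₂_le (f := fun (d' : D) (_ : π d' = π d) => D.L d') d rfl

/-- The infimum defining the quotient seminorm is attained. -/
theorem IsQuantumIsometry.exists_lift {π : D →⋆ₐ[ℂ] A} (hπ : IsQuantumIsometry π) {a : A}
    {l : ℝ≥0} (ha : A.L a ≤ l) : ∃ d : D, D.L d ≤ l ∧ π d = a := by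
  have hsa := QCMS.isSelfAdjoint_of_le ha
  have hstep : ∀ δ : ℝ≥0, 0 < δ → ∃ d : D, D.L d ≤ (l + δ : ℝ≥0) ∧ π d = a := by
    intro δ hδ
    have : (⨅ (d : D) (_ : π d = a), D.L d) < (l + δ : ℝ≥0) := by
      rw [← hπ.L_eq a hsa]
      exact ha.trans_lt (by exact_mod_cast lt_add_of_pos_right l hδ)
    obtain ⟨d, hd⟩ := iInf_lt_iff.1 this
    obtain ⟨hd', hd⟩ := iInf_lt_iff.1 hd
    exact ⟨d, hd.le, hd'⟩
  obtain ⟨R, hR⟩ := exists_norm_sub_scalar_le D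
  -- A lift is within `(l + 1) R` of a scalar `t`; applying `π` bounds `|t|` in terms of `‖a‖`. So
  -- all nearly optimal lifts lie in one compact set, and a cluster point is an optimal lift.
  have hbound : ∀ d : D, D.L d ≤ (l + 1 : ℝ≥0) → π d = a → ‖d‖ ≤ ‖a‖ + 2 * ((l + 1) * R) := by
    intro d hd hda
    obtain ⟨t, ht⟩ := hR _ d hd
    have h1 : ‖(t : ℂ) • (1 : A)‖ ≤ ‖a‖ + (l + 1) * R := by
      have h2 : ‖a - (t : ℂ) • (1 : A)‖ ≤ (l + 1) * R := by
        have := NonUnitalStarAlgHom.norm_apply_le π (d - (t : ℂ) • (1 : D))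
        rw [map_sub, map_smul, map_one, hda] at this
        refine this.trans (ht.trans_eq (by push_cast; ring))
      have := norm_sub_le a (a - (t : ℂ) • (1 : A))
      rw [sub_sub_cancel] at this
      linarith
    have h3 : ‖d‖ ≤ ‖d - (t : ℂ) • (1 : D)‖ + ‖(t : ℂ) • (1 : D)‖ := by
      simpa using norm_add_le (d - (t : ℂ) • (1 : D)) ((t : ℂ) • (1 : D))
    rw [norm_smul, norm_one] at h1 h3
    push_cast at ht
    linarith
  have hpos : ∀ n : ℕ, (0 : ℝ≥0) < ((n : ℝ≥0) + 1)⁻¹ := fun n => by positivity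
  choose d hd hda using fun n : ℕ => hstep ((n : ℝ≥0) + 1)⁻¹ (hpos n)
  have hK : ∀ n, d n ∈ {d : D | D.L d ≤ (l + 1 : ℝ≥0) ∧ ‖d‖ ≤ ‖a‖ + 2 * ((l + 1) * R)} := by
    intro n
    have : D.L (d n) ≤ (l + 1 : ℝ≥0) := (hd n).trans (by
      have : ((n : ℝ≥0) + 1)⁻¹ ≤ 1 := inv_le_one_of_one_le₀ (by simp)
      exact_mod_cast add_le_add_right this l)
    exact ⟨this, hbound _ this (hda n)⟩
  obtain ⟨d₀, -, j, hj, hlim⟩ := (isCompact_setOf_L_le_norm_le _ _).tendsto_subseq hK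
  refine ⟨d₀, ?_, ?_⟩
  · refine ENNReal.le_of_forall_pos_le_add fun ε hε _ => ?_
    rw [← ENNReal.coe_add]
    refine (isClosed_setOf_L_le (A := D) (l + ε)).mem_of_tendsto hlim ?_
    have h0 : Tendsto (fun n : ℕ => ((n : ℝ≥0) + 1)⁻¹) atTop (𝓝 0) := by
      have := tendsto_one_div_add_atTop_nhds_zero_nat (𝕜 := ℝ≥0)
      simpa using this
    filter_upwards [(h0.comp hj.tendsto_atTop).eventually_le_const hε] with n hn
    refine (hd (j n)).trans ?_
    exact_mod_cast add_le_add_right hn l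
  · have hc : Continuous π := AddMonoidHomClass.continuous_of_bound π 1
        fun a => by simpa using NonUnitalStarAlgHom.norm_apply_le π a
    refine tendsto_nhds_unique ((hc.tendsto d₀).comp hlim) ?_
    simp only [Function.comp_def, hda]
    exact tendsto_const_nhds

/-- States compute the norm of the self-adjoint `d`, and every state of `D` is `ε`-close to one
factoring through `π`, on which `d` is bounded by `‖π d‖`. -/
theorem norm_le_norm_map_add {π : D →⋆ₐ[ℂ] A} {ε : ℝ≥0}
    (hε : (letI := mkEMetric D.L
      Metric.hausdorffEDist (Set.univ : Set (StateSpace D)) (Set.range (pullback π))) < ε)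
    {d : D} {l : ℝ≥0} (hd : D.L d ≤ l) : ‖d‖ ≤ ‖π d‖ + l * ε := by
  have hsa := QCMS.isSelfAdjoint_of_le hd
  refine norm_le_of_forall_state hsa fun μ => ?_
  let := mkEMetric D.L
  obtain ⟨_, ⟨ν, rfl⟩, hν⟩ := Metric.exists_edist_lt_of_hausdorffEDist_lt (Set.mem_univ μ) hε
  have h1 : edist (μ.1 d) ((pullback π ν).1 d) ≤ (l * ε : ℝ≥0) := by
    rw [ENNReal.coe_mul]
    exact (edist_state_le hd _ _).trans (mul_le_mul_right (le_of_lt hν) _)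
  have h2 : ‖(pullback π ν).1 d‖ ≤ ‖π d‖ := StateSpace.norm_apply_le ν (hsa.map π)
  rw [edist_nndist, ENNReal.coe_le_coe, ← NNReal.coe_le_coe, coe_nndist, dist_eq_norm] at h1
  have h3 := norm_add_le (μ.1 d - (pullback π ν).1 d) ((pullback π ν).1 d)
  rw [sub_add_cancel] at h3
  push_cast at h1
  linarith

theorem Tunnel.extent_inv (τ : Tunnel A B) : τ.inv.extent = τ.extent := max_comm _ _

theorem Tunnel.norm_le_dom_add (τ : Tunnel A B) {ε : ℝ≥0} (hε : τ.extent < ε) {d : τ.D} {l : ℝ≥0}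
    (hd : τ.D.L d ≤ l) : ‖d‖ ≤ ‖τ.dom d‖ + l * ε :=
  norm_le_norm_map_add ((le_max_left _ _).trans_lt hε) hd

theorem Tunnel.norm_le_cod_add (τ : Tunnel A B) {ε : ℝ≥0} (hε : τ.extent < ε) {d : τ.D} {l : ℝ≥0}
    (hd : τ.D.L d ≤ l) : ‖d‖ ≤ ‖τ.cod d‖ + l * ε :=
  norm_le_norm_map_add ((le_max_right _ _).trans_lt hε) hd

end Tunnels

/-! ### Elements with bounded real and imaginary parts, and their products -/

section Bounded

/-- `d` is of the form `p + i q` with `p, q` self-adjoint of L-seminorm and norm at most `l`. -/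
def QCMS.IsBdd (D : QCMS.{u} F) (l : ℝ≥0) (d : D) : Prop :=
  ∃ p q : D, D.L p ≤ l ∧ D.L q ≤ l ∧ ‖p‖ ≤ l ∧ ‖q‖ ≤ l ∧ d = p + Complex.I • q

variable {D A B : QCMS.{u} F}

theorem QCMS.IsBdd.mono {l m : ℝ≥0} {d : D} (h : D.IsBdd l d) (hlm : l ≤ m) : D.IsBdd m d := by
  obtain ⟨p, q, h1, h2, h3, h4, rfl⟩ := h
  have e : (l : ℝ≥0∞) ≤ m := by exact_mod_cast hlm
  have e' : (l : ℝ) ≤ m := by exact_mod_cast hlm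
  exact ⟨p, q, h1.trans e, h2.trans e, h3.trans e', h4.trans e', rfl⟩

theorem QCMS.isBdd_of_le {l m : ℝ≥0} {p : D} (h : D.L p ≤ l) (h' : ‖p‖ ≤ m) :
    D.IsBdd (l + m) p := by
  refine ⟨p, 0, h.trans (by simp), by simp [D.L_zero], h'.trans (by simp), by simp; positivity, by simp⟩

theorem QCMS.IsBdd.norm_le {l : ℝ≥0} {d : D} (h : D.IsBdd l d) : ‖d‖ ≤ 2 * l := by
  obtain ⟨p, q, -, -, h3, h4, rfl⟩ := h
  refine (norm_add_le _ _).trans ?_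
  rw [norm_smul, Complex.norm_I, one_mul]
  linarith

theorem QCMS.IsBdd.add {l m : ℝ≥0} {d e : D} (hd : D.IsBdd l d) (he : D.IsBdd m e) :
    D.IsBdd (l + m) (d + e) := by
  obtain ⟨p, q, h1, h2, h3, h4, rfl⟩ := hd
  obtain ⟨p', q', h1', h2', h3', h4', rfl⟩ := he
  refine ⟨p + p', q + q', QCMS.add_le h1 h1', QCMS.add_le h2 h2', ?_, ?_, ?_⟩
  · push_cast; exact (norm_add_le _ _).trans (add_le_add h3 h3')
  · push_cast; exact (norm_add_le _ _).trans (add_le_add h4 h4')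
  · rw [smul_add]; abel

theorem QCMS.IsBdd.I_smul {l : ℝ≥0} {d : D} (hd : D.IsBdd l d) : D.IsBdd l (Complex.I • d) := by
  obtain ⟨p, q, h1, h2, h3, h4, rfl⟩ := hd
  refine ⟨-q, p, by rwa [D.L_neg], h1, by rwa [norm_neg], h3, ?_⟩
  rw [smul_add, smul_smul, Complex.I_mul_I, neg_one_smul, add_comm]

theorem QCMS.IsBdd.real_smul {l : ℝ≥0} {d : D} (hd : D.IsBdd l d) (r : ℝ) :
    D.IsBdd (‖r‖₊ * l) ((r : ℂ) • d) := by
  obtain ⟨p, q, h1, h2, h3, h4, rfl⟩ := hd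
  refine ⟨(r : ℂ) • p, (r : ℂ) • q, QCMS.smul_le h1 r, QCMS.smul_le h2 r, ?_, ?_, ?_⟩
  · rw [norm_smul, Complex.norm_real]; push_cast; gcongr
  · rw [norm_smul, Complex.norm_real]; push_cast; gcongr
  · rw [smul_add, smul_comm]

theorem QCMS.IsBdd.smul {l : ℝ≥0} {d : D} (hd : D.IsBdd l d) (c : ℂ) :
    D.IsBdd (‖c.re‖₊ * l + ‖c.im‖₊ * l) (c • d) := by
  have h := (hd.real_smul c.re).add (hd.real_smul c.im).I_smul
  have e : c • d = (c.re : ℂ) • d + Complex.I • ((c.im : ℂ) • d) := by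
    rw [smul_smul, ← add_smul, mul_comm Complex.I, Complex.re_add_im]
  rwa [e]

theorem QCMS.IsBdd.neg {l : ℝ≥0} {d : D} (hd : D.IsBdd l d) : D.IsBdd l (-d) := by
  have := hd.real_smul (-1)
  simpa using this

theorem QCMS.IsBdd.sub {l m : ℝ≥0} {d e : D} (hd : D.IsBdd l d) (he : D.IsBdd m e) :
    D.IsBdd (l + m) (d - e) := by
  rw [sub_eq_add_neg]; exact hd.add he.neg

theorem QCMS.IsBdd.star {l : ℝ≥0} {d : D} (hd : D.IsBdd l d) : D.IsBdd l (star d) := by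
  obtain ⟨p, q, h1, h2, h3, h4, rfl⟩ := hd
  refine ⟨p, -q, h1, by rwa [D.L_neg], h3, by rwa [norm_neg], ?_⟩
  rw [star_add, star_smul, (QCMS.isSelfAdjoint_of_le h1).star_eq,
    (QCMS.isSelfAdjoint_of_le h2).star_eq]
  simp

theorem QCMS.IsBdd.L_le {l : ℝ≥0} {d : D} (hd : D.IsBdd l d) (hsa : IsSelfAdjoint d) :
    D.L d ≤ l := by
  obtain ⟨p, q, h1, h2, -, -, rfl⟩ := hd
  have h := hsa.star_eq
  rw [star_add, star_smul, (QCMS.isSelfAdjoint_of_le h1).star_eq,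
    (QCMS.isSelfAdjoint_of_le h2).star_eq, add_right_inj] at h
  -- Self-adjointness of `p + i q` gives `-i q = i q`.
  have : Complex.I • q = 0 := by
    simp only [RCLike.star_def, Complex.conj_I, neg_smul] at h
    have h2 : (2 : ℂ) • (Complex.I • q) = 0 := by
      rw [two_smul]; nth_rewrite 1 [← h]; exact neg_add_cancel _
    exact (smul_eq_zero.1 h2).resolve_left two_ne_zero
  rwa [this, add_zero]

/-- The product is its Jordan part plus `i` times its Lie part, and the quasi-Leibniz inequality
bounds both. The bound depends on `F` and `k` only, hence is uniform over all tunnels. -/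
theorem exists_isBdd_mul_of_L_le (hF : Admissible F) (k : ℝ≥0) : ∃ M : ℝ≥0,
    ∀ (D : QCMS.{u} F) (p q : D), D.L p ≤ k → D.L q ≤ k → ‖p‖ ≤ k → ‖q‖ ≤ k →
      D.IsBdd M (p * q) := by
  refine ⟨(F k k k k).toNNReal + k * k, fun D p q hp hq hp' hq' => ?_⟩
  have hen : ∀ p : D, ‖p‖ ≤ k → ‖p‖ₑ ≤ k := fun p hp => by
    rw [← ofReal_norm]; exact ENNReal.ofReal_le_of_le_toReal (by simpa using hp)
  have h := (D.quasiLeibniz p q (hp.trans_lt ENNReal.coe_lt_top)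
    (hq.trans_lt ENNReal.coe_lt_top)).trans (hF.mono (hen p hp') (hen q hq') hp hq)
  rw [← ENNReal.coe_toNNReal (hF.finite k k k k)] at h
  have hle : ((F k k k k).toNNReal : ℝ≥0∞) ≤ ((F k k k k).toNNReal + k * k : ℝ≥0) := by
    exact_mod_cast le_self_add
  have hpq : ‖p * q‖ ≤ k * k := (norm_mul_le _ _).trans (by gcongr)
  have hqp : ‖q * p‖ ≤ k * k := (norm_mul_le _ _).trans (by gcongr)
  have hle' : (k * k : ℝ) ≤ ((F k k k k).toNNReal + k * k : ℝ≥0) := by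
    push_cast; simp
  refine ⟨jordan p q, lie p q, ((le_max_left _ _).trans h).trans hle,
    ((le_max_right _ _).trans h).trans hle, ?_, ?_, ?_⟩
  · refine le_trans ?_ hle'
    rw [jordan, norm_smul]
    have := norm_add_le (p * q) (q * p)
    simp only [norm_inv, Complex.norm_ofNat]
    linarith
  · refine le_trans ?_ hle'
    rw [lie, norm_smul]
    have := norm_sub_le (p * q) (q * p)
    simp only [norm_inv, norm_mul, Complex.norm_I, Complex.norm_ofNat, mul_one]
    linarith
  · rw [jordan, lie, smul_smul, mul_inv, mul_left_comm, mul_inv_cancel₀ Complex.I_ne_zero, mul_one,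
      ← smul_add]
    have : p * q + q * p + (p * q - q * p) = (2 : ℂ) • (p * q) := by
      rw [two_smul]; abel
    rw [this, smul_smul]; simp

theorem exists_isBdd_mul (hF : Admissible F) (l m : ℝ≥0) : ∃ M : ℝ≥0,
    ∀ (D : QCMS.{u} F) (d e : D), D.IsBdd l d → D.IsBdd m e → D.IsBdd M (d * e) := by
  obtain ⟨M, hM⟩ := exists_isBdd_mul_of_L_le hF (max l m)
  refine ⟨M + M + (M + M), fun D d e hd he => ?_⟩
  obtain ⟨p, q, h1, h2, h3, h4, rfl⟩ := hd.mono (le_max_left l m)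
  obtain ⟨p', q', h1', h2', h3', h4', rfl⟩ := he.mono (le_max_right l m)
  have := ((hM D p p' h1 h1' h3 h3').add (hM D p q' h1 h2' h3 h4').I_smul).add
    ((hM D q p' h2 h1' h4 h3').I_smul.add (hM D q q' h2 h2' h4 h4').I_smul.I_smul)
  convert this using 1
  rw [add_mul, mul_add, mul_add, mul_smul_comm, smul_mul_assoc, smul_mul_assoc, mul_smul_comm]

/-- Apply the self-adjoint estimate to `star d * d`, whose L-seminorm is at most `M`, and use the
C*-identity in all three algebras. -/
theorem Tunnel.exists_norm_sq_le (hF : Admissible F) (l : ℝ≥0) : ∃ M : ℝ≥0,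
    ∀ {A B : QCMS.{u} F} (τ : Tunnel A B) (ε : ℝ≥0), τ.extent < ε → ∀ d : τ.D, τ.D.IsBdd l d →
      ‖d‖ ^ 2 ≤ ‖τ.dom d‖ ^ 2 + M * ε ∧ ‖d‖ ^ 2 ≤ ‖τ.cod d‖ ^ 2 + M * ε := by
  obtain ⟨M, hM⟩ := exists_isBdd_mul hF l l
  refine ⟨M, fun τ ε hε d hd => ?_⟩
  have hL := (hM _ _ _ hd.star hd).L_le (IsSelfAdjoint.star_mul_self d)
  have h1 := τ.norm_le_dom_add hε hL
  have h2 := τ.norm_le_cod_add hε hL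
  rw [map_mul, map_star, CStarRing.norm_star_mul_self, CStarRing.norm_star_mul_self, ← sq, ← sq]
    at h1 h2
  exact ⟨h1, h2⟩

end Bounded

/-! ### Convergence of sequences through tunnels -/

section Lim

variable {A : QCMS.{u} F} {B : ℕ → QCMS.{u} F}

/-- The sequence `x` of elements of the spaces `B n` converges to `a : A` through the tunnels `τ n`,
along lifts whose L-seminorms and norms are bounded. -/
def Lim (τ : ∀ n, Tunnel A (B n)) (𝓕 : Filter ℕ) (x : ∀ n, B n) (a : A) : Prop :=
  ∃ (l : ℝ≥0) (d : ∀ n, (τ n).D), (∀ᶠ n in 𝓕, (τ n).D.IsBdd l (d n)) ∧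
    Tendsto (fun n => (τ n).dom (d n)) 𝓕 (𝓝 a) ∧
    Tendsto (fun n => ‖x n - (τ n).cod (d n)‖) 𝓕 (𝓝 0)

variable {τ : ∀ n, Tunnel A (B n)} {𝓕 𝓖 : Filter ℕ} {x y : ∀ n, B n} {a b : A}

theorem Lim.mono (h : Lim τ 𝓕 x a) (hle : 𝓖 ≤ 𝓕) : Lim τ 𝓖 x a := by
  obtain ⟨l, d, h1, h2, h3⟩ := h
  exact ⟨l, d, hle h1, h2.mono_left hle, h3.mono_left hle⟩

theorem Lim.congr_norm (h : Lim τ 𝓕 x a) (hxy : Tendsto (fun n => ‖y n - x n‖) 𝓕 (𝓝 0)) :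
    Lim τ 𝓕 y a := by
  obtain ⟨l, d, h1, h2, h3⟩ := h
  refine ⟨l, d, h1, h2, squeeze_zero (fun _ => norm_nonneg _) (fun n => ?_)
    (by simpa using hxy.add h3)⟩
  simpa using norm_add_le (y n - x n) (x n - (τ n).cod (d n))

theorem Lim.add (hx : Lim τ 𝓕 x a) (hy : Lim τ 𝓕 y b) : Lim τ 𝓕 (fun n => x n + y n) (a + b) := by
  obtain ⟨l, d, h1, h2, h3⟩ := hx
  obtain ⟨m, e, h1', h2', h3'⟩ := hy
  refine ⟨l + m, fun n => d n + e n, ?_, ?_, squeeze_zero (fun _ => norm_nonneg _) (fun n => ?_)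
    (by simpa using h3.add h3')⟩
  · filter_upwards [h1, h1'] with n hn hn' using hn.add hn'
  · simpa only [map_add] using h2.add h2'
  · rw [map_add, add_sub_add_comm]; exact norm_add_le _ _

theorem Lim.smul (hx : Lim τ 𝓕 x a) (c : ℂ) : Lim τ 𝓕 (fun n => c • x n) (c • a) := by
  obtain ⟨l, d, h1, h2, h3⟩ := hx
  refine ⟨_, fun n => c • d n, h1.mono fun n hn => hn.smul c, ?_, ?_⟩
  · simpa only [map_smul] using h2.const_smul c
  · simpa only [map_smul, ← smul_sub, norm_smul, mul_zero] using h3.const_mul ‖c‖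

theorem Lim.sub (hx : Lim τ 𝓕 x a) (hy : Lim τ 𝓕 y b) : Lim τ 𝓕 (fun n => x n - y n) (a - b) := by
  simpa [sub_eq_add_neg] using hx.add (hy.smul (-1))

theorem Lim.one : Lim τ 𝓕 (fun _ => 1) 1 := by
  refine ⟨0 + 1, fun _ => 1, .of_forall fun n => QCMS.isBdd_of_le ?_ (by simp), ?_, ?_⟩
  · simp [QCMS.L_one]
  · simp only [map_one]; exact tendsto_const_nhds
  · simp only [map_one, sub_self, norm_zero]; exact tendsto_const_nhds

theorem Lim.scalar (c : ℂ) : Lim τ 𝓕 (fun n => c • (1 : B n)) (c • (1 : A)) := Lim.one.smul c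

theorem Tunnel.norm_dom_le {A B : QCMS.{u} F} (τ : Tunnel A B) (d : τ.D) : ‖τ.dom d‖ ≤ ‖d‖ :=
  NonUnitalStarAlgHom.norm_apply_le _ d

theorem Tunnel.norm_cod_le {A B : QCMS.{u} F} (τ : Tunnel A B) (d : τ.D) : ‖τ.cod d‖ ≤ ‖d‖ :=
  NonUnitalStarAlgHom.norm_apply_le _ d

theorem eventually_extent_lt (hτ : Tendsto (fun n => (τ n).extent) 𝓕 (𝓝 0)) {ε : ℝ≥0}
    (hε : 0 < ε) : ∀ᶠ n in 𝓕, (τ n).extent < ε :=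
  hτ.eventually_lt_const (by exact_mod_cast hε)

theorem tendsto_norm_dom_sq_sub_norm_cod_sq (hF : Admissible F)
    (hτ : Tendsto (fun n => (τ n).extent) 𝓕 (𝓝 0)) {l : ℝ≥0} {d : ∀ n, (τ n).D}
    (hd : ∀ᶠ n in 𝓕, (τ n).D.IsBdd l (d n)) :
    Tendsto (fun n => ‖d n‖ ^ 2 - ‖(τ n).dom (d n)‖ ^ 2) 𝓕 (𝓝 0) ∧
    Tendsto (fun n => ‖d n‖ ^ 2 - ‖(τ n).cod (d n)‖ ^ 2) 𝓕 (𝓝 0) := by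
  obtain ⟨M, hM⟩ := Tunnel.exists_norm_sq_le hF l
  have key : ∀ ε : ℝ, 0 < ε → ∀ᶠ n in 𝓕, ‖d n‖ ^ 2 - ‖(τ n).dom (d n)‖ ^ 2 < ε ∧
      ‖d n‖ ^ 2 - ‖(τ n).cod (d n)‖ ^ 2 < ε := by
    intro ε hε
    have hpos : 0 < ε / (M + 1) := by positivity
    filter_upwards [eventually_extent_lt hτ (ε := ⟨ε / (M + 1), hpos.le⟩) hpos, hd] with n hn hdn
    have h := hM (τ n) _ hn _ hdn
    have h' : (M : ℝ) * (ε / (M + 1)) < ε := by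
      rw [mul_div_assoc', div_lt_iff₀ (by positivity)]
      nlinarith
    change _ ≤ _ + (M : ℝ) * (ε / (M + 1)) ∧ _ ≤ _ + (M : ℝ) * (ε / (M + 1)) at h
    constructor <;> linarith [h.1, h.2]
  have h0 : ∀ n, 0 ≤ ‖d n‖ ^ 2 - ‖(τ n).dom (d n)‖ ^ 2 ∧
      0 ≤ ‖d n‖ ^ 2 - ‖(τ n).cod (d n)‖ ^ 2 := fun n => by
    have h1 := (τ n).norm_dom_le (d n)
    have h2 := (τ n).norm_cod_le (d n)
    constructor <;> rw [sub_nonneg] <;> gcongr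
  constructor <;> rw [Metric.tendsto_nhds] <;> intro ε hε <;> filter_upwards [key ε hε] with n hn
  · rw [dist_zero_right, Real.norm_of_nonneg (h0 n).1]; exact hn.1
  · rw [dist_zero_right, Real.norm_of_nonneg (h0 n).2]; exact hn.2

theorem tendsto_norm_of_tendsto_norm_cod (hF : Admissible F)
    (hτ : Tendsto (fun n => (τ n).extent) 𝓕 (𝓝 0)) {l : ℝ≥0} {d : ∀ n, (τ n).D}
    (hd : ∀ᶠ n in 𝓕, (τ n).D.IsBdd l (d n))
    (h0 : Tendsto (fun n => ‖(τ n).cod (d n)‖) 𝓕 (𝓝 0)) : Tendsto (fun n => ‖d n‖) 𝓕 (𝓝 0) := by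
  have h := (tendsto_norm_dom_sq_sub_norm_cod_sq hF hτ hd).2.add (h0.pow 2)
  have := h.sqrt
  simpa using this

/-- Both `‖dom d‖²` and `‖cod d‖²` differ from `‖d‖²` by a null sequence. This is the source of
uniqueness of limits and of all norm bounds. -/
theorem Lim.tendsto_norm (hF : Admissible F) (hτ : Tendsto (fun n => (τ n).extent) 𝓕 (𝓝 0))
    (h : Lim τ 𝓕 x a) : Tendsto (fun n => ‖x n‖) 𝓕 (𝓝 ‖a‖) := by
  obtain ⟨l, d, h1, h2, h3⟩ := h
  obtain ⟨e1, e2⟩ := tendsto_norm_dom_sq_sub_norm_cod_sq hF hτ h1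
  have e3 : Tendsto (fun n => ‖(τ n).cod (d n)‖ ^ 2) 𝓕 (𝓝 (‖a‖ ^ 2)) := by
    have := ((h2.norm.pow 2).add e1).sub e2
    simpa using this
  have e4 : Tendsto (fun n => ‖(τ n).cod (d n)‖) 𝓕 (𝓝 ‖a‖) := by
    have := e3.sqrt
    simpa using this
  have e5 : Tendsto (fun n => ‖x n‖ - ‖(τ n).cod (d n)‖) 𝓕 (𝓝 0) :=
    squeeze_zero_norm (fun n => abs_norm_sub_norm_le _ _) h3
  simpa using e5.add e4

/-- Products of bounded lifts are bounded lifts, by `exists_isBdd_mul`. -/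
theorem Lim.mul (hF : Admissible F) (hτ : Tendsto (fun n => (τ n).extent) 𝓕 (𝓝 0))
    (hx : Lim τ 𝓕 x a) (hy : Lim τ 𝓕 y b) : Lim τ 𝓕 (fun n => x n * y n) (a * b) := by
  have hxn := hx.tendsto_norm hF hτ
  obtain ⟨l, d, h1, h2, h3⟩ := hx
  obtain ⟨m, e, h1', h2', h3'⟩ := hy
  obtain ⟨M, hM⟩ := exists_isBdd_mul hF l m
  refine ⟨M, fun n => d n * e n, ?_, ?_, ?_⟩
  · filter_upwards [h1, h1'] with n hn hn' using hM _ _ _ hn hn'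
  · simpa only [map_mul] using h2.mul h2'
  · have ht : Tendsto (fun n => ‖x n‖ * ‖y n - (τ n).cod (e n)‖ +
        ‖x n - (τ n).cod (d n)‖ * (2 * m)) 𝓕 (𝓝 0) := by
      simpa using (hxn.mul h3').add (h3.mul_const (2 * (m : ℝ)))
    refine squeeze_zero' (.of_forall fun _ => norm_nonneg _) ?_ ht
    filter_upwards [h1'] with n hn
    have hc : ‖(τ n).cod (e n)‖ ≤ 2 * m := ((τ n).norm_cod_le _).trans hn.norm_le
    have : x n * y n - (τ n).cod (d n * e n) =
        x n * (y n - (τ n).cod (e n)) + (x n - (τ n).cod (d n)) * (τ n).cod (e n) := by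
      rw [map_mul, mul_sub, sub_mul]; abel
    rw [this]
    refine (norm_add_le _ _).trans (add_le_add (norm_mul_le _ _) ((norm_mul_le _ _).trans ?_))
    gcongr

theorem Lim.eq_of_tendsto_norm_sub [𝓕.NeBot] (hF : Admissible F)
    (hτ : Tendsto (fun n => (τ n).extent) 𝓕 (𝓝 0)) (hx : Lim τ 𝓕 x a) (hy : Lim τ 𝓕 y b)
    (h : Tendsto (fun n => ‖x n - y n‖) 𝓕 (𝓝 0)) : a = b := by
  have := tendsto_nhds_unique ((hx.sub hy).tendsto_norm hF hτ) h
  exact sub_eq_zero.1 (norm_eq_zero.1 this)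

theorem Lim.tendsto_norm_sub (hF : Admissible F)
    (hτ : Tendsto (fun n => (τ n).extent) 𝓕 (𝓝 0)) (hx : Lim τ 𝓕 x a) (hy : Lim τ 𝓕 y a) :
    Tendsto (fun n => ‖x n - y n‖) 𝓕 (𝓝 0) := by
  simpa using (hx.sub hy).tendsto_norm hF hτ

/-- A bound on L alone suffices: once the extent is below `1`, the norms of the lifts are controlled
by those of their images in `A`. -/
theorem lim_cod_of_L_le (hτ : Tendsto (fun n => (τ n).extent) 𝓕 (𝓝 0)) {l : ℝ≥0}
    {d : ∀ n, (τ n).D} (hd : ∀ n, (τ n).D.L (d n) ≤ l)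
    (h : Tendsto (fun n => (τ n).dom (d n)) 𝓕 (𝓝 a)) : Lim τ 𝓕 (fun n => (τ n).cod (d n)) a := by
  refine ⟨l + (‖a‖₊ + 1 + l), d, ?_, h, by simpa using tendsto_const_nhds⟩
  filter_upwards [eventually_extent_lt hτ one_pos,
    h.norm.eventually_le_const (lt_add_one ‖a‖)] with n hn hn'
  refine QCMS.isBdd_of_le (hd n) (((τ n).norm_le_dom_add hn (hd n)).trans ?_)
  push_cast
  linarith

/-- The difference between `d n` and the lifts witnessing the limit is bounded, with image tending
to `0` in `B n`; hence it tends to `0` in the tunnel and so does its image in `A`. -/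
theorem Lim.tendsto_dom_of_L_le (hF : Admissible F)
    (hτ : Tendsto (fun n => (τ n).extent) 𝓕 (𝓝 0)) {l : ℝ≥0}
    {d : ∀ n, (τ n).D} (hd : ∀ n, (τ n).D.L (d n) ≤ l)
    (h : Lim τ 𝓕 (fun n => (τ n).cod (d n)) a) :
    Tendsto (fun n => (τ n).dom (d n)) 𝓕 (𝓝 a) := by
  have hn := h.tendsto_norm hF hτ
  obtain ⟨m, e, h1, h2, h3⟩ := h
  have hb : ∀ᶠ n in 𝓕, (τ n).D.IsBdd (l + (‖a‖₊ + 1 + l) + m) (d n - e n) := by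
    filter_upwards [eventually_extent_lt hτ one_pos, hn.eventually_le_const (lt_add_one ‖a‖), h1]
      with n hn hn' hn1
    refine (QCMS.isBdd_of_le (hd n) (((τ n).norm_le_cod_add hn (hd n)).trans ?_)).sub hn1
    push_cast
    linarith
  have h4 := tendsto_norm_of_tendsto_norm_cod hF hτ hb (by simpa only [map_sub] using h3)
  have h5 : Tendsto (fun n => (τ n).dom (d n - e n)) 𝓕 (𝓝 0) :=
    squeeze_zero_norm (fun n => (τ n).norm_dom_le _) h4
  simpa using h5.add h2

theorem exists_lim_of_L_le (hτ : Tendsto (fun n => (τ n).extent) 𝓕 (𝓝 0)) {l : ℝ≥0}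
    (ha : A.L a ≤ l) : ∃ x : ∀ n, B n, (∀ n, (B n).L (x n) ≤ l) ∧ Lim τ 𝓕 x a := by
  choose d hd hda using fun n => (τ n).dom_isometry.exists_lift ha
  refine ⟨fun n => (τ n).cod (d n), fun n => ((τ n).cod_isometry.L_map_le _).trans (hd n),
    lim_cod_of_L_le hτ hd ?_⟩
  simp only [hda]; exact tendsto_const_nhds

end Lim

/-! ### Density of domains and extension of bounded graphs -/

section Dense

variable {A B : QCMS.{u} F}

theorem dense_of_dom_le (p : Submodule ℂ A) (h : ∀ a : A, A.L a < ⊤ → a ∈ p) :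
    Dense (p : Set A) := by
  have hsa : ∀ a : A, IsSelfAdjoint a → a ∈ p.topologicalClosure := fun a ha =>
    closure_mono (fun b hb => h b hb) (A.dense_dom a ha)
  intro a
  change a ∈ p.topologicalClosure
  rw [← realPart_add_I_smul_imaginaryPart a]
  exact add_mem (hsa _ (realPart a).2)
    (p.topologicalClosure.smul_mem _ (hsa _ (imaginaryPart a).2))

theorem clm_ext_dom {E : Type*} [NormedAddCommGroup E] [NormedSpace ℂ E] {f g : A →L[ℂ] E}
    (h : ∀ a : A, A.L a < ⊤ → f a = g a) : f = g := by
  have hd := dense_of_dom_le (LinearMap.eqLocus f.toLinearMap g.toLinearMap) h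
  exact DFunLike.coe_injective (Continuous.ext_on hd f.continuous g.continuous fun a ha => ha)

theorem LipMap.map_isSelfAdjoint (φ : LipMap A B) {a : A} (ha : IsSelfAdjoint a) :
    IsSelfAdjoint (φ.toCLM a) := by
  have hc : IsClosed {b : A | IsSelfAdjoint (φ.toCLM b)} :=
    isClosed_eq (continuous_star.comp φ.toCLM.continuous) φ.toCLM.continuous
  exact closure_minimal (fun b hb => B.isSelfAdjoint_of_lt_top _ (φ.map_dom b hb)) hc
    (A.dense_dom a ha)

theorem LipMap.map_star (φ : LipMap A B) (a : A) : φ.toCLM (star a) = star (φ.toCLM a) := by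
  rw [← realPart_add_I_smul_imaginaryPart a]
  have h1 := (φ.map_isSelfAdjoint (realPart a).2).star_eq
  have h2 := (φ.map_isSelfAdjoint (imaginaryPart a).2).star_eq
  have h3 := (realPart a).2.star_eq
  have h4 := (imaginaryPart a).2.star_eq
  rw [star_add, star_smul, h3, h4, map_add, map_add, map_smul, map_smul, star_add, star_smul, h1, h2]

/-- The norm bound makes the graph single-valued and bounded, so it extends by density and
completeness. -/
theorem exists_clm_of_graph {E E' : Type*} [NormedAddCommGroup E] [NormedSpace ℂ E]
    [NormedAddCommGroup E'] [NormedSpace ℂ E'] [CompleteSpace E'] (G : Submodule ℂ (E × E'))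
    (K : ℝ≥0) (hG : ∀ p ∈ G, ‖p.2‖ ≤ K * ‖p.1‖)
    (hd : Dense (G.map (LinearMap.fst ℂ E E') : Set E)) :
    ∃ T : E →L[ℂ] E', ‖T‖ ≤ K ∧ ∀ p ∈ G, T p.1 = p.2 := by
  let f : G →ₗ[ℂ] E' := (LinearMap.snd ℂ E E').comp G.subtype
  let e : G →ₗ[ℂ] E := (LinearMap.fst ℂ E E').comp G.subtype
  have he : DenseRange e := by
    have : Set.range e = (G.map (LinearMap.fst ℂ E E') : Set E) := by
      ext z; simp [e]
    rw [DenseRange, this]; exact hd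
  have hn : ∀ x : G, ‖f x‖ ≤ K * ‖e x‖ := fun x => hG _ x.2
  exact ⟨f.extendOfNorm e, LinearMap.opNorm_extendOfNorm_le he K.coe_nonneg hn,
    fun p hp => LinearMap.extendOfNorm_eq he ⟨K, hn⟩ ⟨p, hp⟩⟩

theorem edist_apply_le_mkDist (φ ψ : LipMap A B) {a : A} (ha : A.L a ≤ 1) :
    edist (φ.toCLM a) (ψ.toCLM a) ≤ mkDist φ ψ :=
  le_iSup₂_of_le (f := fun a (_ : A.L a ≤ 1) => edist (φ.toCLM a) (ψ.toCLM a)) a ha le_rfl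

theorem edist_apply_le_mul_mkDist (φ ψ : LipMap A B) {a : A} {l : ℝ≥0} (ha : A.L a ≤ l) :
    edist (φ.toCLM a) (ψ.toCLM a) ≤ l * mkDist φ ψ := by
  rcases eq_or_ne l 0 with rfl | hl
  · obtain ⟨r, rfl⟩ := (A.L_eq_zero a).1 (by simpa using ha)
    rw [map_smul, map_smul, φ.map_one, ψ.map_one]; simp
  · have h1 : A.L ((((l⁻¹ : ℝ≥0) : ℝ) : ℂ) • a) ≤ 1 := by
      have := QCMS.smul_le ha ((l⁻¹ : ℝ≥0) : ℝ)
      have e : ‖((l⁻¹ : ℝ≥0) : ℝ)‖₊ * l = 1 := by simp [hl]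
      rwa [e] at this
    have h2 := edist_apply_le_mkDist φ ψ h1
    have e : ∀ φ : LipMap A B, φ.toCLM a = (l : ℝ) • φ.toCLM ((((l⁻¹ : ℝ≥0) : ℝ) : ℂ) • a) :=
      fun φ => by
        rw [map_smul, ← Complex.coe_smul, smul_smul]
        simp [hl]
    rw [e φ, e ψ, edist_smul₀]
    have : ‖(l : ℝ)‖₊ = l := by simp
    rw [this, ENNReal.smul_def, smul_eq_mul]
    gcongr

end Dense

/-! ### Forward target sets -/

section Forward

variable {A B A' B' : QCMS.{u} F} {τ : Tunnel A B} {τ' : Tunnel A' B'} {φ : LipMap B B'}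

theorem mem_forwardTargetSet_iff {a : A} {l D : ℝ≥0} {c : A'} :
    c ∈ forwardTargetSet τ φ τ'.inv a l D ↔ ∃ (d : τ.D) (e : τ'.D), τ.D.L d ≤ l ∧ τ.dom d = a ∧
      τ'.D.L e ≤ (D * l : ℝ≥0) ∧ τ'.cod e = φ.toCLM (τ.cod d) ∧ τ'.dom e = c := by
  constructor
  · intro h
    obtain ⟨y, hy, h⟩ := Set.mem_iUnion₂.1 h
    obtain ⟨b, ⟨d, hd0, hd, hda, rfl⟩, rfl⟩ := hy
    obtain ⟨e, he0, he, hec, hed⟩ := h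
    exact ⟨d, e, hd, hda, he, hec, hed⟩
  · rintro ⟨d, e, hd, hda, he, hec, hed⟩
    exact Set.mem_iUnion₂.2 ⟨φ.toCLM (τ.cod d),
      ⟨τ.cod d, ⟨d, QCMS.isSelfAdjoint_of_le hd, hd, hda, rfl⟩, rfl⟩,
      ⟨e, QCMS.isSelfAdjoint_of_le he, he, hec, hed⟩⟩

theorem forwardTargetSet_nonempty {a : A} {l D : ℝ≥0} (ha : A.L a ≤ l) (hφ : φ.DilationLE D) :
    (forwardTargetSet τ φ τ'.inv a l D).Nonempty := by
  obtain ⟨d, hd, hda⟩ := τ.dom_isometry.exists_lift ha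
  have h1 : B.L (τ.cod d) ≤ l := (τ.cod_isometry.L_map_le d).trans hd
  have h2 : B'.L (φ.toCLM (τ.cod d)) ≤ (D * l : ℝ≥0) := by
    rw [ENNReal.coe_mul]
    exact (hφ _ (QCMS.isSelfAdjoint_of_le h1)).trans (by gcongr)
  obtain ⟨e, he, hec⟩ := τ'.cod_isometry.exists_lift h2
  exact ⟨τ'.dom e, mem_forwardTargetSet_iff.2 ⟨d, e, hd, hda, he, hec, rfl⟩⟩

theorem LipMap.DilationLE.mono {D D' : ℝ≥0} (h : φ.DilationLE D) (hD : D ≤ D') :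
    φ.DilationLE D' := fun a ha => (h a ha).trans (by gcongr)

theorem L_le_of_mem_forwardTargetSet {a : A} {l D : ℝ≥0} {c : A'}
    (hc : c ∈ forwardTargetSet τ φ τ'.inv a l D) : A'.L c ≤ (D * l : ℝ≥0) := by
  obtain ⟨d, e, -, -, he, -, rfl⟩ := mem_forwardTargetSet_iff.1 hc
  exact (τ'.dom_isometry.L_map_le e).trans he

/-- Follow the differences of lifts through both tunnels: each crossing costs the L-bound times `ε`,
and the map costs a factor `K`. Used for equicontinuity in `a` and, against `0`, for boundedness. -/
theorem norm_sub_le_of_mem_forwardTargetSet {K ε : ℝ≥0} (hφ : ‖φ.toCLM‖ ≤ K)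
    (hτ : τ.extent < ε) (hτ' : τ'.extent < ε) {a b : A} {l m D : ℝ≥0} {c c' : A'}
    (hc : c ∈ forwardTargetSet τ φ τ'.inv a l D) (hc' : c' ∈ forwardTargetSet τ φ τ'.inv b m D) :
    ‖c - c'‖ ≤ K * (‖a - b‖ + (l + m) * ε) + (D * l + D * m) * ε := by
  obtain ⟨d, e, hd, rfl, he, hed, rfl⟩ := mem_forwardTargetSet_iff.1 hc
  obtain ⟨d', e', hd', rfl, he', hed', rfl⟩ := mem_forwardTargetSet_iff.1 hc'
  have h1 := τ.norm_le_dom_add hτ (QCMS.sub_le hd hd')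
  have h2 := τ'.norm_le_cod_add hτ' (QCMS.sub_le he he')
  have h3 := τ.norm_cod_le (d - d')
  have h4 := τ'.norm_dom_le (e - e')
  have h5 : ‖τ'.cod (e - e')‖ ≤ K * ‖τ.cod (d - d')‖ := by
    rw [map_sub, hed, hed', ← map_sub, ← map_sub]
    exact φ.toCLM.le_of_opNorm_le hφ _
  have h6 : (K : ℝ) * ‖τ.cod (d - d')‖ ≤ K * (‖τ.dom (d - d')‖ + (l + m : ℝ≥0) * ε) := by
    gcongr; exact h3.trans h1
  rw [map_sub] at h1 h4
  rw [map_sub τ.dom] at h6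
  push_cast at h2 h6
  linarith

theorem zero_mem_forwardTargetSet (D : ℝ≥0) : (0 : A') ∈ forwardTargetSet τ φ τ'.inv 0 0 D :=
  mem_forwardTargetSet_iff.2 ⟨0, 0, by simp [QCMS.L_zero], by simp, by simp [QCMS.L_zero],
    by simp, by simp⟩

end Forward

/-! ### Limits of sequences of linear maps -/

section Converges

variable {A A' A'' : QCMS.{u} F} {B B' B'' : ℕ → QCMS.{u} F}

/-- The linear map `Ψ` is the limit of the maps `φ n` along `𝓕`, through the tunnels `τ n` and
`τ' n`. -/
def Converges (τ : ∀ n, Tunnel A (B n)) (τ' : ∀ n, Tunnel A' (B' n)) (𝓕 : Filter ℕ)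
    (φ : ∀ n, LipMap (B n) (B' n)) (Ψ : A →L[ℂ] A') : Prop :=
  ∀ a : A, A.L a < ⊤ → ∃ x : ∀ n, B n, Lim τ 𝓕 x a ∧ Lim τ' 𝓕 (fun n => (φ n).toCLM (x n)) (Ψ a)

variable {τ : ∀ n, Tunnel A (B n)} {τ' : ∀ n, Tunnel A' (B' n)} {τ'' : ∀ n, Tunnel A'' (B'' n)}
  {𝓕 𝓖 : Filter ℕ} {φ ψ : ∀ n, LipMap (B n) (B' n)} {Ψ Θ : A →L[ℂ] A'} {K : ℝ≥0}

theorem Converges.mono (h : Converges τ τ' 𝓕 φ Ψ) (hle : 𝓖 ≤ 𝓕) : Converges τ τ' 𝓖 φ Ψ :=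
  fun a ha => let ⟨x, h1, h2⟩ := h a ha; ⟨x, h1.mono hle, h2.mono hle⟩

theorem converges_id (hτ : Tendsto (fun n => (τ n).extent) 𝓕 (𝓝 0)) :
    Converges τ τ 𝓕 (fun n => LipMap.id (B n)) (ContinuousLinearMap.id ℂ A) := fun a ha => by
  lift A.L a to ℝ≥0 using ha.ne with l hl
  obtain ⟨x, -, hx⟩ := exists_lim_of_L_le (τ := τ) hτ hl.symm.le
  exact ⟨x, hx, hx⟩

theorem Lim.tendsto_norm_apply_sub (hF : Admissible F)
    (hτ : Tendsto (fun n => (τ n).extent) 𝓕 (𝓝 0)) (hφ : ∀ n, ‖(φ n).toCLM‖ ≤ K) {a : A}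
    {x y : ∀ n, B n} (hx : Lim τ 𝓕 x a) (hy : Lim τ 𝓕 y a) :
    Tendsto (fun n => ‖(φ n).toCLM (x n) - (φ n).toCLM (y n)‖) 𝓕 (𝓝 0) := by
  have h := (hx.tendsto_norm_sub hF hτ hy).const_mul (K : ℝ)
  rw [mul_zero] at h
  refine squeeze_zero (fun _ => norm_nonneg _) (fun n => ?_) h
  rw [← map_sub]
  exact (φ n).toCLM.le_of_opNorm_le (hφ n) _

/-- The limit does not depend on the approximating sequence: two of them are asymptotic, and the
maps are uniformly bounded. -/
theorem Converges.lim_apply (h : Converges τ τ' 𝓕 φ Ψ) (hF : Admissible F)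
    (hτ : Tendsto (fun n => (τ n).extent) 𝓕 (𝓝 0)) (hφ : ∀ n, ‖(φ n).toCLM‖ ≤ K) {a : A}
    (ha : A.L a < ⊤) {x : ∀ n, B n} (hx : Lim τ 𝓕 x a) :
    Lim τ' 𝓕 (fun n => (φ n).toCLM (x n)) (Ψ a) := by
  obtain ⟨y, hy, hy'⟩ := h a ha
  exact hy'.congr_norm (hx.tendsto_norm_apply_sub hF hτ hφ hy)

theorem norm_le_of_lim [𝓕.NeBot] (hF : Admissible F)
    (hτ : Tendsto (fun n => (τ n).extent) 𝓕 (𝓝 0)) (hτ' : Tendsto (fun n => (τ' n).extent) 𝓕 (𝓝 0))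
    (hφ : ∀ n, ‖(φ n).toCLM‖ ≤ K) {a : A} {b : A'} {x : ∀ n, B n} (hx : Lim τ 𝓕 x a)
    (hb : Lim τ' 𝓕 (fun n => (φ n).toCLM (x n)) b) : ‖b‖ ≤ K * ‖a‖ :=
  le_of_tendsto_of_tendsto' (hb.tendsto_norm hF hτ') ((hx.tendsto_norm hF hτ).const_mul (K : ℝ))
    fun n => (φ n).toCLM.le_of_opNorm_le (hφ n) _

/-- The graph of the limit of the maps `φ n`, on elements reached by bounded lifts. -/
def limGraph (τ : ∀ n, Tunnel A (B n)) (τ' : ∀ n, Tunnel A' (B' n)) (𝓕 : Filter ℕ)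
    (φ : ∀ n, LipMap (B n) (B' n)) : Submodule ℂ (A × A') where
  carrier := {p | ∃ x : ∀ n, B n, Lim τ 𝓕 x p.1 ∧ Lim τ' 𝓕 (fun n => (φ n).toCLM (x n)) p.2}
  zero_mem' := ⟨fun _ => 0, by simpa using Lim.scalar (τ := τ) 0, by
    simpa using Lim.scalar (τ := τ') (𝓕 := 𝓕) 0⟩
  add_mem' := by
    rintro _ _ ⟨x, h1, h2⟩ ⟨y, h1', h2'⟩
    exact ⟨fun n => x n + y n, h1.add h1', by simpa using h2.add h2'⟩
  smul_mem' := by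
    rintro c _ ⟨x, h1, h2⟩
    exact ⟨fun n => c • x n, h1.smul c, by simpa using h2.smul c⟩

theorem exists_converges [𝓕.NeBot] (hF : Admissible F)
    (hτ : Tendsto (fun n => (τ n).extent) 𝓕 (𝓝 0)) (hτ' : Tendsto (fun n => (τ' n).extent) 𝓕 (𝓝 0))
    (hφ : ∀ n, ‖(φ n).toCLM‖ ≤ K)
    (h : ∀ a : A, A.L a < ⊤ → ∃ (b : A') (x : ∀ n, B n),
      Lim τ 𝓕 x a ∧ Lim τ' 𝓕 (fun n => (φ n).toCLM (x n)) b) :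
    ∃ Ψ : A →L[ℂ] A', ‖Ψ‖ ≤ K ∧ Converges τ τ' 𝓕 φ Ψ := by
  obtain ⟨T, hT, hT'⟩ := exists_clm_of_graph (limGraph τ τ' 𝓕 φ) K
    (fun p ⟨x, h1, h2⟩ => norm_le_of_lim hF hτ hτ' hφ h1 h2) (dense_of_dom_le _ fun a ha => by
      obtain ⟨b, hb⟩ := h a ha
      exact ⟨(a, b), hb, rfl⟩)
  refine ⟨T, hT, fun a ha => ?_⟩
  obtain ⟨b, x, h1, h2⟩ := h a ha
  refine ⟨x, h1, ?_⟩
  rwa [hT' (a, b) ⟨x, h1, h2⟩]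

/-- Here `a` need not lie in the domain of L, which matters for products, as these are rarely
self-adjoint. The operator built from the whole limit graph agrees with `Ψ` on the domain, hence
everywhere. -/
theorem Converges.apply_eq [𝓕.NeBot] (h : Converges τ τ' 𝓕 φ Ψ) (hF : Admissible F)
    (hτ : Tendsto (fun n => (τ n).extent) 𝓕 (𝓝 0)) (hτ' : Tendsto (fun n => (τ' n).extent) 𝓕 (𝓝 0))
    (hφ : ∀ n, ‖(φ n).toCLM‖ ≤ K) {a : A} {b : A'} {x : ∀ n, B n} (hx : Lim τ 𝓕 x a)
    (hb : Lim τ' 𝓕 (fun n => (φ n).toCLM (x n)) b) : Ψ a = b := by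
  obtain ⟨T, -, hT'⟩ := exists_clm_of_graph (limGraph τ τ' 𝓕 φ) K
    (fun p ⟨x, h1, h2⟩ => norm_le_of_lim hF hτ hτ' hφ h1 h2) (dense_of_dom_le _ fun a ha => by
      obtain ⟨x, hx⟩ := h a ha
      exact ⟨(a, Ψ a), ⟨x, hx⟩, rfl⟩)
  have : Ψ = T := clm_ext_dom fun c hc => by
    obtain ⟨y, hy⟩ := h c hc
    exact (hT' (c, Ψ c) ⟨y, hy⟩).symm
  rw [this]
  exact hT' (a, b) ⟨x, hx, hb⟩

theorem exists_lim_of_mem_forwardTargetSet (hτ : Tendsto (fun n => (τ n).extent) 𝓕 (𝓝 0))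
    (hτ' : Tendsto (fun n => (τ' n).extent) 𝓕 (𝓝 0)) {a : A} {l D : ℝ≥0} {c : ℕ → A'} {b : A'}
    (hc : ∀ n, c n ∈ forwardTargetSet (τ n) (φ n) (τ' n).inv a l D) (h : Tendsto c 𝓕 (𝓝 b)) :
    ∃ x : ∀ n, B n, Lim τ 𝓕 x a ∧ Lim τ' 𝓕 (fun n => (φ n).toCLM (x n)) b := by
  choose d e hd hda he hed hec using fun n => mem_forwardTargetSet_iff.1 (hc n)
  refine ⟨fun n => (τ n).cod (d n), lim_cod_of_L_le hτ hd ?_, ?_⟩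
  · simp only [hda]; exact tendsto_const_nhds
  · simp only [← hed]
    refine lim_cod_of_L_le hτ' he ?_
    simpa only [hec] using h

theorem Converges.tendsto_of_mem_forwardTargetSet (h : Converges τ τ' 𝓕 φ Ψ) (hF : Admissible F)
    (hτ : Tendsto (fun n => (τ n).extent) 𝓕 (𝓝 0)) (hτ' : Tendsto (fun n => (τ' n).extent) 𝓕 (𝓝 0))
    (hφ : ∀ n, ‖(φ n).toCLM‖ ≤ K) {a : A} (ha : A.L a < ⊤) {l D : ℝ≥0} {c : ℕ → A'}
    (hc : ∀ n, c n ∈ forwardTargetSet (τ n) (φ n) (τ' n).inv a l D) :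
    Tendsto c 𝓕 (𝓝 (Ψ a)) := by
  choose d e hd hda he hed hec using fun n => mem_forwardTargetSet_iff.1 (hc n)
  have h1 : Lim τ 𝓕 (fun n => (τ n).cod (d n)) a := lim_cod_of_L_le hτ hd (by
    simp only [hda]; exact tendsto_const_nhds)
  have h2 := h.lim_apply hF hτ hφ ha h1
  simp only [← hed] at h2
  simpa only [hec] using h2.tendsto_dom_of_L_le hF hτ' he

theorem Converges.tendsto_hausdorffEDist (h : Converges τ τ' 𝓕 φ Ψ) (hF : Admissible F)
    (hτ : Tendsto (fun n => (τ n).extent) 𝓕 (𝓝 0)) (hτ' : Tendsto (fun n => (τ' n).extent) 𝓕 (𝓝 0))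
    (hφ : ∀ n, ‖(φ n).toCLM‖ ≤ K) {a : A} {l D : ℝ≥0} (ha : A.L a ≤ l)
    (hD : ∀ n, (φ n).DilationLE D) :
    Tendsto (fun n => Metric.hausdorffEDist
      (forwardTargetSet (τ n) (φ n) (τ' n).inv a l D) {Ψ a}) 𝓕 (𝓝 0) := by
  rw [ENNReal.tendsto_nhds_zero]
  intro ε hε
  by_contra hcon
  -- Choose an element farther than `ε` from `Ψ a` whenever there is one. Convergence of this one
  -- selection then controls the entire sets.
  have hex : ∀ n, ∃ c ∈ forwardTargetSet (τ n) (φ n) (τ' n).inv a l D,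
      edist c (Ψ a) ≤ ε → Metric.hausdorffEDist
        (forwardTargetSet (τ n) (φ n) (τ' n).inv a l D) {Ψ a} ≤ ε := by
    intro n
    obtain ⟨c₀, hc₀⟩ := forwardTargetSet_nonempty (τ := τ n) (τ' := τ' n) ha (hD n)
    by_cases hb : ∃ c ∈ forwardTargetSet (τ n) (φ n) (τ' n).inv a l D, ε < edist c (Ψ a)
    · obtain ⟨c, hc, hc'⟩ := hb
      exact ⟨c, hc, fun h => absurd hc' h.not_gt⟩
    · push Not at hb
      refine ⟨c₀, hc₀, fun _ => Metric.hausdorffEDist_le_of_mem_edist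
        (fun c hc => ⟨_, rfl, hb c hc⟩) ?_⟩
      rintro _ rfl
      exact ⟨c₀, hc₀, by rw [edist_comm]; exact hb c₀ hc₀⟩
  choose c hc hc' using hex
  have hlim := h.tendsto_of_mem_forwardTargetSet hF hτ hτ' hφ (ha.trans_lt ENNReal.coe_lt_top) hc
  have := ENNReal.tendsto_nhds_zero.1 (tendsto_iff_edist_tendsto_0.1 hlim) ε hε
  exact hcon (this.mono hc')

/-- `Ψ a` is a limit of forward targets, all lying in the closed set `L ≤ D l`. -/
theorem Converges.L_le [𝓕.NeBot] (h : Converges τ τ' 𝓕 φ Ψ) (hF : Admissible F)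
    (hτ : Tendsto (fun n => (τ n).extent) 𝓕 (𝓝 0)) (hτ' : Tendsto (fun n => (τ' n).extent) 𝓕 (𝓝 0))
    (hφ : ∀ n, ‖(φ n).toCLM‖ ≤ K) {a : A} {l D : ℝ≥0} (ha : A.L a ≤ l)
    (hD : ∀ n, (φ n).DilationLE D) : A'.L (Ψ a) ≤ (D * l : ℝ≥0) := by
  choose c hc using fun n => forwardTargetSet_nonempty (τ := τ n) (τ' := τ' n) ha (hD n)
  have hlim := h.tendsto_of_mem_forwardTargetSet hF hτ hτ' hφ (ha.trans_lt ENNReal.coe_lt_top) hc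
  exact (isClosed_setOf_L_le (A := A') (D * l)).mem_of_tendsto hlim
    (.of_forall fun n => L_le_of_mem_forwardTargetSet (hc n))

theorem Converges.map_one [𝓕.NeBot] (h : Converges τ τ' 𝓕 φ Ψ) (hF : Admissible F)
    (hτ : Tendsto (fun n => (τ n).extent) 𝓕 (𝓝 0)) (hτ' : Tendsto (fun n => (τ' n).extent) 𝓕 (𝓝 0))
    (hφ : ∀ n, ‖(φ n).toCLM‖ ≤ K) : Ψ 1 = 1 :=
  h.apply_eq hF hτ hτ' hφ Lim.one (by simpa only [LipMap.map_one] using Lim.one)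

/-- If forward targets of elements approximating `a` converge, then so do the forward targets
of `a`. -/
theorem exists_tendsto_of_mem_forwardTargetSet [𝓕.NeBot]
    (hτ : Tendsto (fun n => (τ n).extent) 𝓕 (𝓝 0)) (hτ' : Tendsto (fun n => (τ' n).extent) 𝓕 (𝓝 0))
    (hφ : ∀ n, ‖(φ n).toCLM‖ ≤ K) {a : A} {l D : ℝ≥0} {c : ℕ → A'}
    (hc : ∀ n, c n ∈ forwardTargetSet (τ n) (φ n) (τ' n).inv a l D)
    (h : ∀ δ : ℝ, 0 < δ → ∃ (b : A) (m : ℝ≥0) (c' : ℕ → A') (w : A'), ‖a - b‖ < δ ∧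
      (∀ n, c' n ∈ forwardTargetSet (τ n) (φ n) (τ' n).inv b m D) ∧ Tendsto c' 𝓕 (𝓝 w)) :
    ∃ w, Tendsto c 𝓕 (𝓝 w) := by
  refine cauchy_map_iff_exists_tendsto.1 ?_
  rw [Metric.cauchy_iff]
  refine ⟨inferInstance, fun ε hε => ?_⟩
  -- This `δ` makes `K ‖a - b‖` at most `ε / 8`. The constant `C` collects the coefficients of the
  -- extents, giving another `ε / 8`, and `c'` is eventually within `ε / 8` of `w`, for a total
  -- below `ε / 2`.
  obtain ⟨b, m, c', w, hb, hc', hw⟩ := h (ε / (8 * (K + 1))) (by positivity)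
  set C : ℝ≥0 := K * (l + m) + (D * l + D * m) with hC
  have hpos : 0 < ε / (8 * (C + 1)) := by positivity
  refine ⟨c '' {n | dist (c n) w < ε / 2}, image_mem_map ?_, ?_⟩
  · filter_upwards [eventually_extent_lt hτ (ε := ⟨_, hpos.le⟩) hpos,
      eventually_extent_lt hτ' (ε := ⟨_, hpos.le⟩) hpos,
      Metric.tendsto_nhds.1 hw (ε / 8) (by positivity)] with n h1 h2 h3
    have h4 := norm_sub_le_of_mem_forwardTargetSet (hφ n) h1 h2 (hc n) (hc' n)
    change _ ≤ K * (_ + (l + m) * (ε / (8 * (C + 1)))) + (D * l + D * m) * (ε / (8 * (C + 1))) at h4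
    have h5 : (K : ℝ) * ‖a - b‖ ≤ ε / 8 := by
      calc (K : ℝ) * ‖a - b‖ ≤ (K + 1) * (ε / (8 * (K + 1))) := by gcongr; simp
        _ = ε / 8 := by field_simp
    have h6 : (C : ℝ) * (ε / (8 * (C + 1))) ≤ ε / 8 := by
      calc (C : ℝ) * (ε / (8 * (C + 1))) ≤ (C + 1) * (ε / (8 * (C + 1))) := by gcongr; simp
        _ = ε / 8 := by field_simp
    have h7 : (C : ℝ) = K * (l + m) + (D * l + D * m) := by rw [hC]; push_cast; ring
    have h8 : ‖c n - c' n‖ ≤ ε / 8 + ε / 8 := by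
      refine h4.trans ?_
      have : (K : ℝ) * (‖a - b‖ + (l + m) * (ε / (8 * (C + 1)))) +
          (D * l + D * m) * (ε / (8 * (C + 1))) = K * ‖a - b‖ + C * (ε / (8 * (C + 1))) := by
        rw [h7]; ring
      rw [this]; exact add_le_add h5 h6
    change dist (c n) w < ε / 2
    have := dist_triangle (c n) (c' n) w
    rw [← dist_eq_norm] at h8
    linarith
  · rintro _ ⟨n, hn, rfl⟩ _ ⟨k, hk, rfl⟩
    have := dist_triangle_right (c n) (c k) w
    have hn' : dist (c n) w < ε / 2 := hn
    have hk' : dist (c k) w < ε / 2 := hk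
    linarith

end Converges

/-! ### Properties inherited by limits: composition, products, positivity, distances -/

section ConvergesProperties

variable {A A' A'' : QCMS.{u} F} {B B' B'' : ℕ → QCMS.{u} F}

variable {τ : ∀ n, Tunnel A (B n)} {τ' : ∀ n, Tunnel A' (B' n)} {τ'' : ∀ n, Tunnel A'' (B'' n)}
  {𝓕 𝓖 : Filter ℕ} {φ ψ : ∀ n, LipMap (B n) (B' n)} {K K' : ℝ≥0}

theorem tendsto_norm_apply_sub_of_tendsto_mkDist {l : ℝ≥0} {x : ∀ n, B n}
    (hx : ∀ n, (B n).L (x n) ≤ l) (h : Tendsto (fun n => mkDist (φ n) (ψ n)) 𝓕 (𝓝 0)) :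
    Tendsto (fun n => ‖(φ n).toCLM (x n) - (ψ n).toCLM (x n)‖) 𝓕 (𝓝 0) := by
  have h1 : Tendsto (fun n => l * mkDist (φ n) (ψ n)) 𝓕 (𝓝 0) := by
    simpa using ENNReal.Tendsto.const_mul (a := (l : ℝ≥0∞)) h (.inr ENNReal.coe_ne_top)
  have h2 : Tendsto (fun n => edist ((φ n).toCLM (x n)) ((ψ n).toCLM (x n))) 𝓕 (𝓝 0) :=
    tendsto_of_tendsto_of_tendsto_of_le_of_le tendsto_const_nhds h1 (fun _ => zero_le)
      fun n => edist_apply_le_mul_mkDist (φ n) (ψ n) (hx n)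
  have h3 := (ENNReal.tendsto_toReal ENNReal.zero_ne_top).comp h2
  simpa only [Function.comp_def, edist_dist, dist_eq_norm, ENNReal.toReal_ofReal (norm_nonneg _),
    ENNReal.toReal_zero] using h3

/-- An element of the domain has approximants of bounded L-seminorm, on which the two sequences of
maps are asymptotic. This turns the asymptotic functor identities into exact ones. -/
theorem Converges.eq_of_tendsto_mkDist [𝓕.NeBot] {Ψ Θ : A →L[ℂ] A'} (hF : Admissible F)
    (hτ : Tendsto (fun n => (τ n).extent) 𝓕 (𝓝 0)) (hτ' : Tendsto (fun n => (τ' n).extent) 𝓕 (𝓝 0))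
    (hφ : ∀ n, ‖(φ n).toCLM‖ ≤ K) (hψ : ∀ n, ‖(ψ n).toCLM‖ ≤ K')
    (h : Converges τ τ' 𝓕 φ Ψ) (h' : Converges τ τ' 𝓕 ψ Θ)
    (hmk : Tendsto (fun n => mkDist (φ n) (ψ n)) 𝓕 (𝓝 0)) : Ψ = Θ := by
  refine clm_ext_dom fun a ha => ?_
  lift A.L a to ℝ≥0 using ha.ne with l hl
  obtain ⟨x, hx, hxa⟩ := exists_lim_of_L_le (τ := τ) hτ hl.symm.le
  have hat : A.L a < ⊤ := hl ▸ ENNReal.coe_lt_top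
  exact (h.lim_apply hF hτ hφ hat hxa).eq_of_tendsto_norm_sub hF hτ'
    (h'.lim_apply hF hτ hψ hat hxa) (tendsto_norm_apply_sub_of_tendsto_mkDist hx hmk)

theorem Converges.comp {θ : ∀ n, LipMap (B' n) (B'' n)} {Ψ : A →L[ℂ] A'} {Θ : A' →L[ℂ] A''}
    (hF : Admissible F) (hτ' : Tendsto (fun n => (τ' n).extent) 𝓕 (𝓝 0))
    (hθ : ∀ n, ‖(θ n).toCLM‖ ≤ K)
    (h : Converges τ τ' 𝓕 φ Ψ) (h' : Converges τ' τ'' 𝓕 θ Θ)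
    (hΨ : ∀ a, A.L a < ⊤ → A'.L (Ψ a) < ⊤) :
    Converges τ τ'' 𝓕 (fun n => (θ n).comp (φ n)) (Θ.comp Ψ) := fun a ha => by
  obtain ⟨x, hx, hx'⟩ := h a ha
  exact ⟨x, hx, h'.lim_apply hF hτ' hθ (hΨ a ha) hx'⟩

theorem Converges.map_mul [𝓕.NeBot] {Ψ : A →L[ℂ] A'} (hF : Admissible F)
    (hτ : Tendsto (fun n => (τ n).extent) 𝓕 (𝓝 0)) (hτ' : Tendsto (fun n => (τ' n).extent) 𝓕 (𝓝 0))
    (hφ : ∀ n, ‖(φ n).toCLM‖ ≤ K) (h : Converges τ τ' 𝓕 φ Ψ) (hm : ∀ n, (φ n).IsMorphism)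
    (a b : A) : Ψ (a * b) = Ψ a * Ψ b := by
  have hdom : ∀ a b : A, A.L a < ⊤ → A.L b < ⊤ → Ψ (a * b) = Ψ a * Ψ b := by
    intro a b ha hb
    obtain ⟨x, hx, hx'⟩ := h a ha
    obtain ⟨y, hy, hy'⟩ := h b hb
    refine h.apply_eq hF hτ hτ' hφ (hx.mul hF hτ hy) ?_
    have e : ∀ n, (φ n).toCLM (x n * y n) = (φ n).toCLM (x n) * (φ n).toCLM (y n) := fun n => by
      obtain ⟨π, hπ⟩ := hm n
      rw [← hπ, ← hπ, ← hπ, _root_.map_mul]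
    simpa only [e] using hx'.mul hF hτ' hy'
  -- Both sides are continuous and linear in each variable, so the identity extends from the domain
  -- one variable at a time.
  have h1 : ∀ a b : A, A.L b < ⊤ → Ψ (a * b) = Ψ a * Ψ b := by
    intro a b hb
    have := clm_ext_dom (f := Ψ.comp ((ContinuousLinearMap.mul ℂ A).flip b))
      (g := ((ContinuousLinearMap.mul ℂ A').flip (Ψ b)).comp Ψ) fun c hc => hdom c b hc hb
    exact DFunLike.congr_fun this a
  have := clm_ext_dom (f := Ψ.comp (ContinuousLinearMap.mul ℂ A a))
    (g := ((ContinuousLinearMap.mul ℂ A') (Ψ a)).comp Ψ) fun c hc => h1 a c hc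
  exact DFunLike.congr_fun this b

theorem isPos_of_forall_isPos_add {a : A} (h : ∀ δ : ℝ, 0 < δ → IsPos (a + (δ : ℂ) • (1 : A))) :
    IsPos a := by
  let := CStarAlgebra.spectralOrder A
  have := CStarAlgebra.spectralOrderedRing A
  have hc : IsClosed {b : A | IsPos b} := CStarAlgebra.isClosed_nonneg
  have hl : Tendsto (fun δ : ℝ => a + (δ : ℂ) • (1 : A)) (𝓝[>] 0) (𝓝 a) := by
    have hcont : Continuous (fun δ : ℝ => a + (δ : ℂ) • (1 : A)) := by fun_prop
    have := hcont.tendsto 0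
    simp only [Complex.ofReal_zero, zero_smul, add_zero] at this
    exact this.mono_left nhdsWithin_le_nhds
  exact hc.mem_of_tendsto hl (eventually_mem_nhdsWithin.mono fun δ hδ => h δ hδ)

/-- Positivity of `a` reads `‖‖a‖ - a‖ ≤ ‖a‖`. The norm passes to self-adjoint approximants with an
error `δ`, so `x n + δ` is eventually positive; apply the maps and return to the limit in the same
way. -/
theorem Converges.isPos_apply_of_dom [𝓕.NeBot] {Ψ : A →L[ℂ] A'} (hF : Admissible F)
    (hτ : Tendsto (fun n => (τ n).extent) 𝓕 (𝓝 0)) (hτ' : Tendsto (fun n => (τ' n).extent) 𝓕 (𝓝 0))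
    (hφ : ∀ n, ‖(φ n).toCLM‖ ≤ K) (h : Converges τ τ' 𝓕 φ Ψ) (hp : ∀ n, (φ n).IsPositive)
    (hsa : ∀ a, A.L a < ⊤ → IsSelfAdjoint (Ψ a)) {a : A} (ha : A.L a < ⊤) (hpos : IsPos a) :
    IsPos (Ψ a) := by
  have hat := ha
  have hΨsa := hsa a ha
  lift A.L a to ℝ≥0 using ha.ne with l hl
  obtain ⟨x, hx, hxa⟩ := exists_lim_of_L_le (τ := τ) hτ hl.symm.le
  rw [hl] at hat
  have hxs : ∀ n, IsSelfAdjoint (x n) := fun n => QCMS.isSelfAdjoint_of_le (hx n)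
  have hφx := h.lim_apply hF hτ hφ hat hxa
  refine isPos_of_forall_isPos_add fun δ hδ => ?_
  have h1 : ∀ᶠ n in 𝓕, IsPos ((φ n).toCLM (x n) + (δ : ℂ) • (1 : B' n)) := by
    have hlim := ((Lim.scalar ((‖a‖ : ℝ) : ℂ)).sub hxa).tendsto_norm hF hτ
    have hlt : ‖((‖a‖ : ℝ) : ℂ) • (1 : A) - a‖ < ‖a‖ + δ :=
      (hpos.norm_norm_sub_le le_rfl).trans_lt (lt_add_of_pos_right _ hδ)
    filter_upwards [hlim.eventually_le_const hlt] with n hn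
    have := hp n _ (isPos_add_of_norm_sub_le (hxs n) hn)
    rwa [map_add, map_smul, (φ n).map_one] at this
  have h2 := hφx.add (Lim.scalar (δ : ℂ))
  have h3 := h2.tendsto_norm hF hτ'
  -- The extra `1` makes `R` eventually dominate the norms of the approximants.
  set R : ℝ := ‖Ψ a + (δ : ℂ) • (1 : A')‖ + 1 with hR
  have h4 := ((Lim.scalar (R : ℂ)).sub h2).tendsto_norm hF hτ'
  have h5 : ‖(R : ℂ) • (1 : A') - (Ψ a + (δ : ℂ) • (1 : A'))‖ ≤ R := by
    refine le_of_tendsto h4 ?_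
    filter_upwards [h1, h3.eventually_le_const (lt_add_one _)] with n hn hn'
    exact hn.norm_norm_sub_le hn'
  have hsa' : IsSelfAdjoint (Ψ a + (δ : ℂ) • (1 : A')) :=
    hΨsa.add (QCMS.isSelfAdjoint_of_le (l := 0) (A'.L_scalar δ).le)
  have := isPos_add_of_norm_sub_le hsa' (t := 0) (by simpa using h5)
  simpa using this

theorem Converges.isPositive [𝓕.NeBot] {Ψ : LipMap A A'} (hF : Admissible F)
    (hτ : Tendsto (fun n => (τ n).extent) 𝓕 (𝓝 0)) (hτ' : Tendsto (fun n => (τ' n).extent) 𝓕 (𝓝 0))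
    (hφ : ∀ n, ‖(φ n).toCLM‖ ≤ K) (h : Converges τ τ' 𝓕 φ Ψ.toCLM) (hp : ∀ n, (φ n).IsPositive)
    (hd : ∀ a : A, IsPos a → a ∈ closure {b : A | A.L b < ⊤ ∧ IsPos b}) : Ψ.IsPositive := by
  intro a ha
  let := CStarAlgebra.spectralOrder A'
  have := CStarAlgebra.spectralOrderedRing A'
  have hc : IsClosed {b : A | IsPos (Ψ.toCLM b)} :=
    (CStarAlgebra.isClosed_nonneg (A := A')).preimage Ψ.toCLM.continuous
  exact closure_minimal (fun b hb => h.isPos_apply_of_dom hF hτ hτ' hφ hp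
    (fun a ha => A'.isSelfAdjoint_of_lt_top _ (Ψ.map_dom a ha)) hb.1 hb.2) hc (hd a ha)

theorem Converges.isMorphism [𝓕.NeBot] {Ψ : LipMap A A'} (hF : Admissible F)
    (hτ : Tendsto (fun n => (τ n).extent) 𝓕 (𝓝 0)) (hτ' : Tendsto (fun n => (τ' n).extent) 𝓕 (𝓝 0))
    (hφ : ∀ n, ‖(φ n).toCLM‖ ≤ K) (h : Converges τ τ' 𝓕 φ Ψ.toCLM)
    (hm : ∀ n, (φ n).IsMorphism) : Ψ.IsMorphism :=
  ⟨{ toFun := Ψ.toCLM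
     map_one' := Ψ.map_one
     map_mul' := h.map_mul hF hτ hτ' hφ hm
     map_zero' := map_zero _
     map_add' := map_add _
     commutes' := fun c => by
      rw [Algebra.algebraMap_eq_smul_one, map_smul, Ψ.map_one, Algebra.algebraMap_eq_smul_one]
     map_star' := Ψ.map_star }, fun _ => rfl⟩

theorem LipMap.IsMorphism.norm_eq_one {Ψ : LipMap A A'} (h : Ψ.IsMorphism) : ‖Ψ.toCLM‖ = 1 := by
  obtain ⟨π, hπ⟩ := h
  apply le_antisymm
  · refine Ψ.toCLM.opNorm_le_bound zero_le_one fun a => ?_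
    rw [← hπ, one_mul]
    exact NonUnitalStarAlgHom.norm_apply_le π a
  · have := Ψ.toCLM.le_opNorm 1
    rwa [Ψ.map_one, norm_one, norm_one, mul_one] at this

theorem LipMap.one_le_of_norm_le {Ψ : LipMap A A'} (h : ‖Ψ.toCLM‖ ≤ K) : 1 ≤ K := by
  have := Ψ.toCLM.le_of_opNorm_le h 1
  rw [Ψ.map_one, norm_one, norm_one, mul_one] at this
  exact_mod_cast this

theorem Lim.tendsto_edist (hF : Admissible F) (hτ : Tendsto (fun n => (τ n).extent) 𝓕 (𝓝 0))
    {x y : ∀ n, B n} {a b : A} (hx : Lim τ 𝓕 x a) (hy : Lim τ 𝓕 y b) :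
    Tendsto (fun n => edist (x n) (y n)) 𝓕 (𝓝 (edist a b)) := by
  have := ENNReal.tendsto_ofReal ((hx.sub hy).tendsto_norm hF hτ)
  simpa only [← dist_eq_norm, ← edist_dist] using this

/-- The Monge–Kantorovich distances of limits are limits of Monge–Kantorovich distances. -/
theorem Converges.tendsto_mkDist [𝓕.NeBot] {Ψ Θ : LipMap A A'} (hF : Admissible F)
    (hτ : Tendsto (fun n => (τ n).extent) 𝓕 (𝓝 0)) (hτ' : Tendsto (fun n => (τ' n).extent) 𝓕 (𝓝 0))
    (hφ : ∀ n, ‖(φ n).toCLM‖ ≤ K) (hψ : ∀ n, ‖(ψ n).toCLM‖ ≤ K')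
    (h : Converges τ τ' 𝓕 φ Ψ.toCLM) (h' : Converges τ τ' 𝓕 ψ Θ.toCLM) :
    Tendsto (fun n => mkDist (φ n) (ψ n)) 𝓕 (𝓝 (mkDist Ψ Θ)) := by
  refine tendsto_order.2 ⟨fun r hr => ?_, fun r hr => ?_⟩
  -- Lower bound: approximate one test element `a` by elements that keep L at most `1`.
  · obtain ⟨a, ha'⟩ := lt_iSup_iff.1 hr
    obtain ⟨ha, hra⟩ := lt_iSup_iff.1 ha'
    obtain ⟨x, hx, hxa⟩ := exists_lim_of_L_le (τ := τ) (l := 1) hτ ha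
    have hat : A.L a < ⊤ := ha.trans_lt ENNReal.one_lt_top
    have hlim := (h.lim_apply hF hτ hφ hat hxa).tendsto_edist hF hτ' (h'.lim_apply hF hτ hψ hat hxa)
    filter_upwards [hlim.eventually_const_lt hra] with n hn
    exact hn.trans_le (edist_apply_le_mkDist _ _ (hx n))
  -- Upper bound: take near-maximizers where the distance exceeds `s`, lift them, and find a limit
  -- in `A` along an ultrafilter.
  · by_contra hcon
    obtain ⟨s, hs, hsr⟩ := exists_between hr
    have hfreq : ∃ᶠ n in 𝓕, s < mkDist (φ n) (ψ n) :=
      (not_eventually.1 hcon).mono fun n hn => hsr.trans_le (not_lt.1 hn)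
    have hex : ∀ n, ∃ x : B n, (B n).L x ≤ 1 ∧ (s < mkDist (φ n) (ψ n) →
        s < edist ((φ n).toCLM x) ((ψ n).toCLM x)) := by
      intro n
      by_cases hn : s < mkDist (φ n) (ψ n)
      · obtain ⟨x, hx⟩ := lt_iSup_iff.1 hn
        obtain ⟨hx1, hx2⟩ := lt_iSup_iff.1 hx
        exact ⟨x, hx1, fun _ => hx2⟩
      · exact ⟨0, by simp [QCMS.L_zero], fun h => absurd h hn⟩
    choose x hx hxs using hex
    choose d hd hdx using fun n => (τ n).cod_isometry.exists_lift (l := 1) (hx n)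
    obtain ⟨R, hR⟩ := exists_norm_sub_scalar_le A
    choose t ht using fun n => hR 1 ((τ n).dom (d n))
      (((τ n).dom_isometry.L_map_le _).trans (hd n))
    -- Subtracting a scalar puts the images in a compact subset of `A`; it does not affect the
    -- compared values, since all the maps are unital.
    set e : ∀ n, (τ n).D := fun n => d n - ((t n : ℝ) : ℂ) • (1 : (τ n).D) with he
    have heL : ∀ n, (τ n).D.L (e n) ≤ (1 : ℝ≥0) := fun n =>
      (QCMS.L_sub_scalar_le _ _ _).trans (hd n)
    have hmem : ∀ n, (τ n).dom (e n) ∈ {a : A | A.L a ≤ (1 : ℝ≥0) ∧ ‖a‖ ≤ R} := fun n => by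
      refine ⟨((τ n).dom_isometry.L_map_le _).trans (heL n), ?_⟩
      have := ht n
      rw [he, _root_.map_sub, map_smul, _root_.map_one]
      simpa using this
    have hcod : ∀ n, (τ n).cod (e n) = x n - ((t n : ℝ) : ℂ) • (1 : B n) := fun n => by
      rw [he, _root_.map_sub, map_smul, _root_.map_one, hdx]
    have hne : (𝓕 ⊓ 𝓟 {n | s < mkDist (φ n) (ψ n)}).NeBot :=
      frequently_mem_iff_neBot.1 hfreq
    set 𝓤 : Ultrafilter ℕ := Ultrafilter.of (𝓕 ⊓ 𝓟 {n | s < mkDist (φ n) (ψ n)}) with h𝓤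
    have hle : (𝓤 : Filter ℕ) ≤ 𝓕 := (Ultrafilter.of_le _).trans inf_le_left
    have hev : ∀ᶠ n in (𝓤 : Filter ℕ), s < mkDist (φ n) (ψ n) :=
      (Ultrafilter.of_le _).trans inf_le_right (mem_principal_self _)
    obtain ⟨a, ⟨haL, -⟩, ha⟩ := (isCompact_setOf_L_le_norm_le (A := A) 1 R).ultrafilter_le_nhds
      (𝓤.map fun n => (τ n).dom (e n)) (by
        rw [le_principal_iff]; exact Eventually.of_forall (f := (𝓤 : Filter ℕ)) hmem)
    have ha' : Tendsto (fun n => (τ n).dom (e n)) 𝓤 (𝓝 a) := ha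
    have hlim := lim_cod_of_L_le (hτ.mono_left hle) heL ha'
    have hat : A.L a < ⊤ := haL.trans_lt ENNReal.coe_lt_top
    have h1 := ((h.mono hle).lim_apply hF (hτ.mono_left hle) hφ hat hlim).tendsto_edist hF
      (hτ'.mono_left hle) ((h'.mono hle).lim_apply hF (hτ.mono_left hle) hψ hat hlim)
    have h2 : ∀ᶠ n in (𝓤 : Filter ℕ),
        s ≤ edist ((φ n).toCLM ((τ n).cod (e n))) ((ψ n).toCLM ((τ n).cod (e n))) := by
      filter_upwards [hev] with n hn
      have := hxs n hn
      rw [hcod, _root_.map_sub, _root_.map_sub, map_smul, map_smul, (φ n).map_one, (ψ n).map_one,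
        edist_sub_right]
      exact this.le
    have h3 := ge_of_tendsto h1 h2
    exact absurd (h3.trans (edist_apply_le_mkDist Ψ Θ (by simpa using haL))) hs.not_ge

end ConvergesProperties

/-! ### Choice of tunnels, common subsequence and limit functor -/

section Existence

theorem Appropriate.exists_extent_le {𝒯 : TunnelClass.{u} F} {𝒞 : Set (QCMS.{u} F)}
    (h : Appropriate 𝒯 𝒞) {A B : QCMS.{u} F} (hA : A ∈ 𝒞) (hB : B ∈ 𝒞) {δ : ℝ≥0∞} (hδ : δ ≠ 0) :
    ∃ τ ∈ 𝒯 A B, τ.extent ≤ propinquity 𝒯 B A + δ := by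
  rcases eq_or_ne (propinquity 𝒯 B A) ⊤ with ht | ht
  · obtain ⟨τ, hτ⟩ := h.exists_tunnel hA hB
    exact ⟨τ, hτ, by rw [ht, top_add]; exact le_top⟩
  · obtain ⟨τ, hτ⟩ := iInf_lt_iff.1 (ENNReal.lt_add_right ht hδ)
    obtain ⟨hτ, hlt⟩ := iInf_lt_iff.1 hτ
    exact ⟨τ.inv, h.inv_mem hτ, by rw [τ.extent_inv]; exact hlt.le⟩

theorem exists_isCompact_of_mem_forwardTargetSet {A A' : QCMS.{u} F} {B B' : ℕ → QCMS.{u} F}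
    {τ : ∀ n, Tunnel A (B n)} {τ' : ∀ n, Tunnel A' (B' n)} {φ : ∀ n, LipMap (B n) (B' n)} {K : ℝ≥0}
    (hτ : Tendsto (fun n => (τ n).extent) atTop (𝓝 0))
    (hτ' : Tendsto (fun n => (τ' n).extent) atTop (𝓝 0))
    (hφ : ∀ n, ‖(φ n).toCLM‖ ≤ K) {a : A} {l D : ℝ≥0} {c : ℕ → A'}
    (hc : ∀ n, c n ∈ forwardTargetSet (τ n) (φ n) (τ' n).inv a l D) :
    ∃ Q : Set A', IsCompact Q ∧ ∀ n, c n ∈ Q := by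
  have hb : ∀ᶠ n in atTop, ‖c n‖ ≤ K * (‖a‖ + l) + D * l := by
    filter_upwards [eventually_extent_lt hτ one_pos, eventually_extent_lt hτ' one_pos] with n h1 h2
    have := norm_sub_le_of_mem_forwardTargetSet (hφ n) h1 h2 (hc n) (zero_mem_forwardTargetSet D)
    simpa using this
  have hb' : IsBoundedUnder (· ≤ ·) atTop fun n => ‖c n‖ := ⟨_, hb⟩
  obtain ⟨R, hR⟩ := hb'.bddAbove_range
  exact ⟨_, isCompact_setOf_L_le_norm_le (D * l) R, fun n =>
    ⟨L_le_of_mem_forwardTargetSet (hc n), hR ⟨n, rfl⟩⟩⟩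

/-- Tychonoff in the countable product, which is first countable, replaces the diagonal argument. -/
theorem exists_strictMono_forall_tendsto {ι : Type*} [Countable ι] {M : ι → Type*}
    [∀ i, TopologicalSpace (M i)] [∀ i, FirstCountableTopology (M i)] {c : ∀ i, ℕ → M i}
    (h : ∀ i, ∃ Q : Set (M i), IsCompact Q ∧ ∀ n, c i n ∈ Q) :
    ∃ j : ℕ → ℕ, StrictMono j ∧ ∀ i, ∃ w, Tendsto (c i ∘ j) atTop (𝓝 w) := by
  choose Q hQ hc using h
  obtain ⟨w, -, j, hj, hw⟩ := (isCompact_univ_pi hQ).tendsto_subseq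
    (x := fun n i => c i n) fun n i _ => hc i n
  exact ⟨j, hj, fun i => ⟨w i, tendsto_pi_nhds.1 hw i⟩⟩

/-- Along a common subsequence, countably many sequences of maps between convergent sequences of
spaces have limits. -/
theorem exists_subseq_converges (hF : Admissible F) {S : Type v} [Category.{w} S] [Countable S]
    [∀ X Y : S, Countable (X ⟶ Y)] {A : S → QCMS.{u} F} {An : ℕ → S → QCMS.{u} F}
    {D : ∀ {X Y : S}, (X ⟶ Y) → ℝ≥0}
    {φ : ∀ (n : ℕ) {X Y : S}, (X ⟶ Y) → LipMap (An n X) (An n Y)}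
    (hnorm : ∀ (n : ℕ) {X Y : S} (s : X ⟶ Y), ‖(φ n s).toCLM‖ ≤ D s)
    (hLip : ∀ (n : ℕ) {X Y : S} (s : X ⟶ Y), (φ n s).DilationLE (D s))
    {τ : ∀ (n : ℕ) (X : S), Tunnel (A X) (An n X)}
    (hτ : ∀ X, Tendsto (fun n => (τ n X).extent) atTop (𝓝 0)) :
    ∃ j : ℕ → ℕ, StrictMono j ∧ ∀ {X Y : S} (s : X ⟶ Y), ∃ Ψ : A X →L[ℂ] A Y, ‖Ψ‖ ≤ D s ∧
      Converges (fun n => τ n X) (fun n => τ n Y) (map j atTop) (fun n => φ n s) Ψ := by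
  -- Domains are separable, so countably many forward-target sequences, indexed by arrows and points
  -- of the dense sets, determine the subsequence.
  choose E hEs hEc hEd using fun X => (isSeparable_dom (A X)).exists_countable_dense_subset
  have := fun X => (hEc X).to_subtype
  have hfin : ∀ X (a : A X), (A X).L a < ⊤ → (A X).L a ≤ ((A X).L a).toNNReal := fun X a ha => by
    rw [ENNReal.coe_toNNReal ha.ne]
  choose c hc using fun (i : Σ (X : S) (Y : S) (_ : X ⟶ Y), E X) (n : ℕ) =>
    forwardTargetSet_nonempty (τ := τ n i.1) (τ' := τ n i.2.1)
      (hfin i.1 i.2.2.2.1 (hEs i.1 i.2.2.2.2)) (hLip n i.2.2.1)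
  obtain ⟨j, hj, hw⟩ := exists_strictMono_forall_tendsto fun i =>
    exists_isCompact_of_mem_forwardTargetSet (hτ i.1) (hτ i.2.1) (fun n => hnorm n i.2.2.1) (hc i)
  have hle : map j atTop ≤ atTop := hj.tendsto_atTop
  refine ⟨j, hj, fun {X Y} s => exists_converges hF ((hτ X).mono_left hle) ((hτ Y).mono_left hle)
    (fun n => hnorm n s) fun a ha => ?_⟩
  choose c' hc' using fun n => forwardTargetSet_nonempty (τ := τ n X) (τ' := τ n Y)
      (hfin X a ha) (hLip n s)
  obtain ⟨b, hb⟩ := exists_tendsto_of_mem_forwardTargetSet ((hτ X).mono_left hle)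
    ((hτ Y).mono_left hle) (fun n => hnorm n s) hc' fun δ hδ => by
      obtain ⟨a', ha', hd⟩ := Metric.mem_closure_iff.1 (hEd X ha) δ hδ
      obtain ⟨w, hw⟩ := hw ⟨X, Y, s, a', ha'⟩
      exact ⟨a', _, _, w, by rwa [← dist_eq_norm], hc ⟨X, Y, s, a', ha'⟩, tendsto_map'_iff.2 hw⟩
  exact ⟨b, exists_lim_of_mem_forwardTargetSet ((hτ X).mono_left hle)
    ((hτ Y).mono_left hle) hc' hb⟩

/-- The functor with prescribed values on objects and morphisms. -/
def functorOfLipMaps {S : Type v} [Category.{w} S] {𝒞 : Set (QCMS.{u} F)} {A : S → QCMS.{u} F}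
    (hA : ∀ X, A X ∈ 𝒞) (Ψ : ∀ {X Y : S}, (X ⟶ Y) → LipMap (A X) (A Y))
    (hid : ∀ X, Ψ (𝟙 X) = LipMap.id (A X))
    (hcomp : ∀ {X Y Z : S} (t : X ⟶ Y) (s : Y ⟶ Z), Ψ (t ≫ s) = (Ψ s).comp (Ψ t)) :
    S ⥤ ClassCat 𝒞 where
  obj X := ClassCat.of (A X) (hA X)
  map s := Ψ s
  map_id := hid
  map_comp := hcomp

theorem arrow_functorOfLipMaps {S : Type v} [Category.{w} S] {𝒞 : Set (QCMS.{u} F)}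
    {A : S → QCMS.{u} F} (hA : ∀ X, A X ∈ 𝒞) (Ψ : ∀ {X Y : S}, (X ⟶ Y) → LipMap (A X) (A Y))
    (hid : ∀ X, Ψ (𝟙 X) = LipMap.id (A X))
    (hcomp : ∀ {X Y Z : S} (t : X ⟶ Y) (s : Y ⟶ Z), Ψ (t ≫ s) = (Ψ s).comp (Ψ t))
    {X Y : S} (s : X ⟶ Y) :
    arrow (hA := hA) (functorOfLipMaps hA Ψ hid hcomp) (fun _ => rfl) s = Ψ s := rfl

theorem liminf_le_and_le_limsup_of_tendsto_subseq {f : ℕ → ℝ≥0∞} {j : ℕ → ℕ} (hj : StrictMono j)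
    {r : ℝ≥0∞} (h : Tendsto f (map j atTop) (𝓝 r)) :
    liminf f atTop ≤ r ∧ r ≤ limsup f atTop := by
  have hle : map j atTop ≤ atTop := hj.tendsto_atTop
  exact ⟨(liminf_le_liminf_of_le hle).trans h.liminf_eq.le,
    h.limsup_eq.ge.trans (limsup_le_limsup_of_le hle)⟩

end Existence

end QuantumMetric

end

/-! ### The main theorem -/

theorem mainTheorem1
    {F : ℝ≥0∞ → ℝ≥0∞ → ℝ≥0∞ → ℝ≥0∞ → ℝ≥0∞} (hF : Admissible F)
    {𝒞 : Set (QCMS.{u} F)} {𝒯 : TunnelClass.{u} F} (h𝒯 : Appropriate 𝒯 𝒞)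
    {S : Type v} [Category.{w} S] [Countable S] [∀ X Y : S, Countable (X ⟶ Y)]
    (A : S → QCMS.{u} F) (hA : ∀ X, A X ∈ 𝒞)
    (An : ℕ → S → QCMS.{u} F) (hAn : ∀ n X, An n X ∈ 𝒞)
    (hlim : ∀ X, Tendsto (fun n => propinquity 𝒯 (An n X) (A X)) atTop (𝓝 0))
    (D : ∀ {X Y : S}, (X ⟶ Y) → ℝ≥0)
    (φ : ∀ (n : ℕ) {X Y : S}, (X ⟶ Y) → LipMap (An n X) (An n Y))
    (hnorm : ∀ (n : ℕ) {X Y : S} (s : X ⟶ Y), ‖(φ n s).toCLM‖ ≤ D s)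
    (hLip : ∀ (n : ℕ) {X Y : S} (s : X ⟶ Y), (φ n s).DilationLE (D s))
    (hcomp : ∀ {X Y Z : S} (t : X ⟶ Y) (s : Y ⟶ Z),
      Tendsto (fun n => mkDist ((φ n s).comp (φ n t)) (φ n (t ≫ s))) atTop (𝓝 0))
    (hunit : ∀ X : S, Tendsto (fun n => mkDist (φ n (𝟙 X)) (LipMap.id (An n X))) atTop (𝓝 0)) :
    ∃ (Ψ : S ⥤ ClassCat 𝒞) (hΨ : ∀ X, Ψ.obj X = ClassCat.of (A X) (hA X)) (j : ℕ → ℕ)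
      (τ : ∀ (n : ℕ) (X : S), Tunnel (A X) (An n X)),
      StrictMono j ∧
      (∀ n X, τ n X ∈ 𝒯 (A X) (An n X)) ∧
      (∀ X, Tendsto (fun n => (τ n X).extent) atTop (𝓝 0)) ∧
      (∀ {X Y : S} (s : X ⟶ Y),
        ‖(arrow Ψ hΨ s).toCLM‖ ≤ √2 * D s ∧ (arrow Ψ hΨ s).DilationLE (D s)) ∧
      (∀ {X Y : S} (s : X ⟶ Y) (a : A X), (A X).L a < ⊤ →
        ∀ l : ℝ≥0, (A X).L a ≤ l → ∀ D' : ℝ≥0, D s ≤ D' →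
          Tendsto (fun n => Metric.hausdorffEDist
            (forwardTargetSet (τ (j n) X) (φ (j n) s) (τ (j n) Y).inv a l D')
            {(arrow Ψ hΨ s).toCLM a}) atTop (𝓝 0)) ∧
      -- positivity
      (∀ {X Y : S} (s : X ⟶ Y), (∀ n, (φ n s).IsPositive) →
        (∀ a : A X, IsPos a → a ∈ closure {b : A X | (A X).L b < ⊤ ∧ IsPos b}) →
        (arrow Ψ hΨ s).IsPositive) ∧
      -- multiplicativity
      (∀ {X Y : S} (s : X ⟶ Y), (∀ n, (φ n s).IsMorphism) →
        (arrow Ψ hΨ s).IsMorphism ∧ ‖(arrow Ψ hΨ s).toCLM‖ = 1) ∧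
      -- Monge–Kantorovich distances
      (∀ {X Y : S} (s s' : X ⟶ Y),
        MapClusterPt (mkDist (arrow Ψ hΨ s) (arrow Ψ hΨ s')) atTop
          (fun n => mkDist (φ n s) (φ n s')) ∧
        liminf (fun n => mkDist (φ n s) (φ n s')) atTop
          ≤ mkDist (arrow Ψ hΨ s) (arrow Ψ hΨ s') ∧
        mkDist (arrow Ψ hΨ s) (arrow Ψ hΨ s')
          ≤ limsup (fun n => mkDist (φ n s) (φ n s')) atTop) ∧
      (∀ {X : S} (s : X ⟶ X),
        liminf (fun n => mkLength (φ n s)) atTop ≤ mkLength (arrow Ψ hΨ s) ∧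
        mkLength (arrow Ψ hΨ s) ≤ limsup (fun n => mkLength (φ n s)) atTop) := by
  choose τ hτmem hτle using fun (n : ℕ) (X : S) => h𝒯.exists_extent_le (hA X) (hAn n X)
    (δ := ((n : ℝ≥0∞) + 1)⁻¹) (by simp)
  have hτ : ∀ X, Tendsto (fun n => (τ n X).extent) atTop (𝓝 0) := fun X => by
    have h0 : Tendsto (fun n : ℕ => ((n : ℝ≥0∞) + 1)⁻¹) atTop (𝓝 0) := by
      have := ENNReal.tendsto_inv_nat_nhds_zero.comp (tendsto_add_atTop_nat 1)
      simpa [Function.comp_def] using this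
    refine tendsto_of_tendsto_of_tendsto_of_le_of_le tendsto_const_nhds
      (by simpa using (hlim X).add h0) (fun _ => zero_le) fun n => hτle n X
  obtain ⟨j, hj, hex⟩ := exists_subseq_converges (D := D) hF hnorm hLip hτ
  choose P hPnorm hP using @hex
  have hle : map j atTop ≤ atTop := hj.tendsto_atTop
  have hτj := fun X => (hτ X).mono_left hle
  -- Unital maps have norm at least `1`, so `D s ≠ 0`; this is needed for `D s * ∞ = ∞` outside the
  -- domain of L.
  have hone : ∀ {X Y : S} (s : X ⟶ Y), D s ≠ 0 := fun s =>
    (zero_lt_one.trans_le (LipMap.one_le_of_norm_le (hnorm 0 s))).ne'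
  have hdil : ∀ {X Y : S} (s : X ⟶ Y) (a : A X), (A Y).L (P s a) ≤ D s * (A X).L a := by
    intro X Y s a
    rcases eq_or_ne ((A X).L a) ⊤ with h | h
    · rw [h, ENNReal.mul_top (by simpa using hone s)]; exact le_top
    · have := (hP s).L_le hF (hτj X) (hτj Y) (fun n => hnorm n s) (ENNReal.coe_toNNReal h).ge
        (fun n => hLip n s)
      rwa [ENNReal.coe_mul, ENNReal.coe_toNNReal h] at this
  let Θ : ∀ {X Y : S}, (X ⟶ Y) → LipMap (A X) (A Y) := fun {X Y} s =>
    { toCLM := P s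
      map_one := (hP s).map_one hF (hτj X) (hτj Y) fun n => hnorm n s
      map_dom := fun a ha => (hdil s a).trans_lt (ENNReal.mul_lt_top ENNReal.coe_lt_top ha) }
  have hidnorm : ∀ X (n : ℕ), ‖(LipMap.id (An n X)).toCLM‖ ≤ (1 : ℝ≥0) := fun X n =>
    ContinuousLinearMap.norm_id_le
  have hΘid : ∀ X, Θ (𝟙 X) = LipMap.id (A X) := fun X => LipMap.ext <|
    (hP (𝟙 X)).eq_of_tendsto_mkDist hF (hτj X) (hτj X) (fun n => hnorm n _) (hidnorm X)
      (converges_id (hτj X)) ((hunit X).mono_left hle)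
  have hΘcomp : ∀ {X Y Z : S} (t : X ⟶ Y) (s : Y ⟶ Z), Θ (t ≫ s) = (Θ s).comp (Θ t) :=
    fun {X Y Z} t s => LipMap.ext <| Eq.symm <|
      ((hP t).comp hF (hτj Y) (fun n => hnorm n s) (hP s) (Θ t).map_dom).eq_of_tendsto_mkDist hF
        (hτj X) (hτj Z) (K := D s * D t) (fun n => by
          push_cast
          exact (ContinuousLinearMap.opNorm_comp_le _ _).trans
            (mul_le_mul (hnorm n s) (hnorm n t) (norm_nonneg _) (D s).coe_nonneg))
        (fun n => hnorm n _) (hP (t ≫ s)) ((hcomp t s).mono_left hle)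
  refine ⟨functorOfLipMaps hA Θ hΘid hΘcomp, fun _ => rfl, j, τ, hj, hτmem, hτ, ?_⟩
  simp only [arrow_functorOfLipMaps]
  refine ⟨fun {X Y} s => ⟨?_, fun a _ => hdil s a⟩, fun {X Y} s a _ l hl D' hD' => ?_,
    fun {X Y} s hp hd => ?_, fun {X Y} s hm => ?_, fun {X Y} s s' => ?_, fun {X} s => ?_⟩
  · refine (hPnorm s).trans (le_mul_of_one_le_left (D s).coe_nonneg ?_)
    exact Real.one_le_sqrt.2 one_le_two
  · exact tendsto_map'_iff.1 ((hP s).tendsto_hausdorffEDist hF (hτj X) (hτj Y)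
      (fun n => hnorm n s) hl fun n => (hLip n s).mono hD')
  · exact Converges.isPositive (Ψ := Θ s) hF (hτj X) (hτj Y) (fun n => hnorm n s) (hP s) hp hd
  · have := Converges.isMorphism (Ψ := Θ s) hF (hτj X) (hτj Y) (fun n => hnorm n s) (hP s) hm
    exact ⟨this, this.norm_eq_one⟩
  · have h := Converges.tendsto_mkDist (Ψ := Θ s) (Θ := Θ s') hF (hτj X) (hτj Y)
      (fun n => hnorm n s) (fun n => hnorm n s') (hP s) (hP s')
    exact ⟨h.mapClusterPt.mono hle, liminf_le_and_le_limsup_of_tendsto_subseq hj h⟩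
  -- The length is a distance to the identity, and the identity is the limit of the identities.
  · exact liminf_le_and_le_limsup_of_tendsto_subseq hj
      (Converges.tendsto_mkDist (Ψ := LipMap.id (A X)) (Θ := Θ s) hF (hτj X) (hτj X) (hidnorm X)
        (fun n => hnorm n s) (converges_id (hτj X)) (hP s))
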